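/- Let $t_0<T$, $n,p,m\ge 0$, and let $F\in L^1(t_0,T;\mathbb R^{n\times n})$, $G\in L^2(t_0,T;\mathbb R^{n\times p})$, $Q\in L^1(t_0,T;\mathbb R^{p\times p})$, $H\in L^2(t_0,T;\mathbb R^{m\times n})$, $R\in L^2(t_0,T;\mathbb R^{m\times m})$, with $Q(t)$ symmetric positive semidefinite for a.e. $t$ and, for some $r>0$, $R(t)$ symmetric with $R(t)\succcurlyeq r\,\mathrm{Id}$ for a.e. $t$. Assume that $GQ^{1/2}\in L^2(t_0,T;\mathbb R^{n\times p})$. Let $\Pi_0,\Sigma_T\in\mathbb R^{n\times n}$ be symmetric positive semidefinite. (Square roots are the positive semidefinite ones; no invertibility of $Q$, $\Pi_0$, $\Sigma_T$ is assumed. Differential equations are understood in the Carathéodory sense: absolutely continuous solutions, equation satisfied a.e.) The Riccati equation $$-\Sigma'=\Sigma F+F^*\Sigma-\Sigma GQG^*\Sigma+H^*R^{-1}H,\qquad \Sigma(T)=\Sigma_T,$$ has a unique solution $\Sigma$ on $[t_0,T]$, and $\Sigma(t)$ is symmetric positive semidefinite for every $t$. Let $\Phi_{F,\Sigma}(s,t)$,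 $s,t\in[t_0,T]$, be the (unique) evolution family of $F-GQG^*\Sigma$, i.e. $\partial_s\Phi_{F,\Sigma}(s,t)=(F(s)-G(s)Q(s)G^*(s)\Sigma(s))\Phi_{F,\Sigma}(s,t)$, $\Phi_{F,\Sigma}(t,t)=\mathrm{Id}$, and set $$K(s,t|T)=\Phi_{F,\Sigma}(s,t_0)\Pi_0^{1/2}\big(\mathrm{Id}+\Pi_0^{1/2}\Sigma(t_0)\Pi_0^{1/2}\big)^{-1}\Pi_0^{1/2}\Phi_{F,\Sigma}^*(t,t_0)+\int_{t_0}^{\min(s,t)}\Phi_{F,\Sigma}(s,\tau)G(\tau)Q(\tau)G^*(\tau)\Phi_{F,\Sigma}^*(t,\tau)\,d\tau .$$ Let $\mathcal S_x$ be the set of absolutely continuous $x:[t_0,T]\to\mathbb R^n$ for which there are $\xi\in\mathbb R^n$ and $u\in L^2(t_0,T;\mathbb R^p)$ with $$x'=Fx+GQ^{1/2}u\ \text{ a.e.},\qquad x(t_0)=\Pi_0^{1/2}\xi .$$ Among the pairs $(\xi,u)$ generating a given $x\in\mathcal S_x$ there is a unique one ($u$ up to a.e. equality) of minimal norm $\int_{t_0}^T\|u\|^2dt+\|\xi\|^2$,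 called the representative of $x$. Then $\mathcal S_x$, with pointwise operations and the inner product $$\langle x^1,x^2\rangle=\langle\xi^1,\xi^2\rangle+\langle\Sigma_Tx^1(T),x^2(T)\rangle+\int_{t_0}^T\langle u^1,u^2\rangle dt+\int_{t_0}^T\langle H^*R^{-1}Hx^1,x^2\rangle dt,$$ where $(\xi^i,u^i)$ is the representative of $x^i$, is a Hilbert space of functions and an $\mathbb R^n$-vector-valued RKHS on $[t_0,T]$. Its squared norm is the quadratic cost $J_x(\xi,u)=\|\xi\|^2+\langle\Sigma_Tx(T),x(T)\rangle+\int_{t_0}^T\|u\|^2dt+\int_{t_0}^T\langle H^*R^{-1}Hx,x\rangle dt$ of the representative, and its reproducing kernel is $K(\cdot,\cdot|T)$: for all $t\in[t_0,T]$ and $z\in\mathbb R^n$, $K(\cdot,t|T)z\in\mathcal S_x$ and $\langle x,K(\cdot,t|T)z\rangle=\langle x(t),z\rangle$ for every $x\in\mathcal S_x$. If moreover $F\in L^2$ and $GQ^{1/2}\in L^\infty$ on $(t_0,T)$, then $\mathcal S_x$ is equal to the set of all $x\in H^1(t_0,T;\mathbb R^n)$ for which such $\xi,u$ exist, and so this space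 of $H^1$ trajectories is the RKHS with kernel $K(\cdot,\cdot|T)$. -/

import Mathlib

open MeasureTheory Set
open scoped InnerProduct MatrixOrder

/-- The Euclidean space `ℝⁿ`. -/
abbrev Vec (n : ℕ) : Type := EuclideanSpace ℝ (Fin n)

/-- The square root `A^{1/2}` of a positive semidefinite operator on `ℝⁿ`: the square root in the
sense of the continuous functional calculus of the matrix of `A` in the canonical basis. -/
noncomputable def posSqrt {n : ℕ} (A : Vec n →L[ℝ] Vec n) : Vec n →L[ℝ] Vec n :=
  Matrix.toEuclideanCLM (𝕜 := ℝ)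
    (CFC.sqrt ((Matrix.toEuclideanCLM (n := Fin n) (𝕜 := ℝ)).symm A))

/-- `A^{1/2} A^{1/2} = A`. -/
theorem posSqrt_comp_self {n : ℕ} {A : Vec n →L[ℝ] Vec n} (hA : A.IsPositive) :
    posSqrt A ∘L posSqrt A = A := by
  have h : ((Matrix.toEuclideanCLM (n := Fin n) (𝕜 := ℝ)).symm A).PosSemidef := by
    rw [← Matrix.isPositive_toEuclideanLin_iff, ← LinearMap.isPositive_toContinuousLinearMap_iff]
    convert! hA
    exact (Matrix.toEuclideanCLM (n := Fin n) (𝕜 := ℝ)).apply_symm_apply A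
  have h2 := CFC.sqrt_mul_sqrt_self _ (Matrix.nonneg_iff_posSemidef.2 h)
  change posSqrt A * posSqrt A = A
  rw [posSqrt, ← map_mul, h2]
  simp

/-- `A^{1/2}` is positive semidefinite. -/
theorem posSqrt_isPositive {n : ℕ} (A : Vec n →L[ℝ] Vec n) : (posSqrt A).IsPositive := by
  have h := Matrix.nonneg_iff_posSemidef.1
    (CFC.sqrt_nonneg ((Matrix.toEuclideanCLM (n := Fin n) (𝕜 := ℝ)).symm A))
  rw [← Matrix.isPositive_toEuclideanLin_iff,
    ← LinearMap.isPositive_toContinuousLinearMap_iff] at h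
  exact h

/-- The data of the linear-quadratic problem on `[t₀, T]`: dynamics `F`, noise/control matrix `G`,
covariances `Q`, `R`, observation matrix `H`, initial covariance `Π₀`, terminal weight `Σ_T`.
Values of the coefficients outside `[t₀, T]` are never used. -/
structure LQData (n p m : ℕ) where
  t₀ : ℝ
  T : ℝ
  lt : t₀ < T
  F : ℝ → Vec n →L[ℝ] Vec n
  G : ℝ → Vec p →L[ℝ] Vec n
  Q : ℝ → Vec p →L[ℝ] Vec p
  H : ℝ → Vec n →L[ℝ] Vec m
  R : ℝ → Vec m →L[ℝ] Vec m
  Pi0 : Vec n →L[ℝ] Vec n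
  SigmaT : Vec n →L[ℝ] Vec n

namespace LQData

variable {n p m : ℕ} (D : LQData n p m)

/-- The time interval `[t₀, T]` as a type; trajectories are functions on it. -/
abbrev Time : Type := ↥(Icc D.t₀ D.T)

/-- The initial time as a point of `[t₀, T]`. -/
def start : D.Time := ⟨D.t₀, left_mem_Icc.2 D.lt.le⟩

/-- The final time as a point of `[t₀, T]`. -/
def final : D.Time := ⟨D.T, right_mem_Icc.2 D.lt.le⟩

/-- Lebesgue measure on `[t₀, T]`. -/
noncomputable def vol : Measure ℝ := volume.restrict (Icc D.t₀ D.T)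

/-- A function on `[t₀, T]` seen as a function on `ℝ` (constant outside the interval), so that it
can be integrated over subintervals of `[t₀, T]`. -/
noncomputable def ext (x : D.Time → Vec n) : ℝ → Vec n := Set.IccExtend D.lt.le x

/-- `G Q^{1/2}`. -/
noncomputable def GQhalf (t : ℝ) : Vec p →L[ℝ] Vec n := D.G t ∘L posSqrt (D.Q t)

/-- `G Q G^*`. -/
noncomputable def GQG (t : ℝ) : Vec n →L[ℝ] Vec n :=
  D.G t ∘L D.Q t ∘L (D.G t).adjoint

/-- `H^* R⁻¹ H`. -/
noncomputable def HRH (t : ℝ) : Vec n →L[ℝ] Vec n :=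
  (D.H t).adjoint ∘L (D.R t).inverse ∘L D.H t

/-- `x` is absolutely continuous on `[t₀, T]` with (weak, equivalently a.e.) derivative
`v ∈ L¹(t₀, T; ℝⁿ)`, i.e. `x` is a primitive of `v`. -/
def HasDerivL1 (x : D.Time → Vec n) (v : ℝ → Vec n) : Prop :=
  Integrable v D.vol ∧ ∀ t : D.Time, x t = x D.start + ∫ τ in D.t₀..(t : ℝ), v τ

/-- `x ∈ H¹(t₀, T; ℝⁿ)` (for the continuous representative): the weak derivative is in `L²`. -/
def MemH1 (x : D.Time → Vec n) : Prop :=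
  ∃ v : ℝ → Vec n, MemLp v 2 D.vol ∧ D.HasDerivL1 x v

/-- The pair `(ξ, u) ∈ ℝⁿ × L²(t₀, T; ℝᵖ)` generates the absolutely continuous trajectory `x`:
`x' = F x + G Q^{1/2} u` a.e. and `x(t₀) = Π₀^{1/2} ξ`. -/
def Generates (ξ : Vec n) (u : ℝ → Vec p) (x : D.Time → Vec n) : Prop :=
  MemLp u 2 D.vol ∧ x D.start = posSqrt D.Pi0 ξ ∧
    D.HasDerivL1 x (fun τ => D.F τ (D.ext x τ) + D.GQhalf τ (u τ))

/-- The space of (absolutely continuous) controlled trajectories. -/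
def trajSpace : Set (D.Time → Vec n) := {x | ∃ ξ u, D.Generates ξ u x}

/-- The space of controlled trajectories of class `H¹`. -/
def trajSpaceH1 : Set (D.Time → Vec n) := {x | D.MemH1 x ∧ ∃ ξ u, D.Generates ξ u x}

/-- `(ξ, u)` is a representative of `x`: it has minimal norm among the pairs generating `x`. -/
def IsRepresentative (ξ : Vec n) (u : ℝ → Vec p) (x : D.Time → Vec n) : Prop :=
  D.Generates ξ u x ∧ ∀ ξ' u', D.Generates ξ' u' x →
    (∫ t in D.t₀..D.T, ‖u t‖ ^ 2) + ‖ξ‖ ^ 2 ≤ (∫ t in D.t₀..D.T, ‖u' t‖ ^ 2) + ‖ξ'‖ ^ 2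

/-- The quadratic cost `J_x(ξ, u)`, where `x` is the trajectory generated by `(ξ, u)`. -/
noncomputable def cost (ξ : Vec n) (u : ℝ → Vec p) (x : D.Time → Vec n) : ℝ :=
  ‖ξ‖ ^ 2 + inner ℝ (D.SigmaT (x D.final)) (x D.final) + (∫ t in D.t₀..D.T, ‖u t‖ ^ 2)
    + ∫ t in D.t₀..D.T, inner ℝ (D.HRH t (D.ext x t)) (D.ext x t)

/-- The bilinear form associated with the quadratic cost. -/
noncomputable def costForm (ξ₁ : Vec n) (u₁ : ℝ → Vec p) (x₁ : D.Time → Vec n)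
    (ξ₂ : Vec n) (u₂ : ℝ → Vec p) (x₂ : D.Time → Vec n) : ℝ :=
  inner ℝ ξ₁ ξ₂ + inner ℝ (D.SigmaT (x₁ D.final)) (x₂ D.final)
    + (∫ t in D.t₀..D.T, inner ℝ (u₁ t) (u₂ t))
    + ∫ t in D.t₀..D.T, inner ℝ (D.HRH t (D.ext x₁ t)) (D.ext x₂ t)

/-- `Σ` solves (in the Carathéodory sense) the backward Riccati equation
`-Σ' = Σ F + F^* Σ - Σ G Q G^* Σ + H^* R⁻¹ H` on `[t₀, T]` with `Σ(T) = Σ_T`. -/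
def IsRiccati (S : ℝ → Vec n →L[ℝ] Vec n) : Prop :=
  ContinuousOn S (Icc D.t₀ D.T) ∧ ∀ t ∈ Icc D.t₀ D.T,
    S t = D.SigmaT + ∫ τ in t..D.T,
      (S τ ∘L D.F τ + (D.F τ).adjoint ∘L S τ - S τ ∘L D.GQG τ ∘L S τ + D.HRH τ)

/-- `Φ(s, t)`, `s, t ∈ [t₀, T]`, is the evolution family of `F - G Q G^* Σ`: for every `t`,
`∂ₛ Φ(s, t) = (F(s) - G(s) Q(s) G(s)^* Σ(s)) Φ(s, t)` (Carathéodory sense) and `Φ(t, t) = Id`. -/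
def IsEvolution (S : ℝ → Vec n →L[ℝ] Vec n) (Φ : ℝ → ℝ → Vec n →L[ℝ] Vec n) : Prop :=
  ∀ t ∈ Icc D.t₀ D.T, ContinuousOn (fun s => Φ s t) (Icc D.t₀ D.T) ∧
    ∀ s ∈ Icc D.t₀ D.T,
      Φ s t = ContinuousLinearMap.id ℝ (Vec n)
        + ∫ τ in t..s, (D.F τ - D.GQG τ ∘L S τ) ∘L Φ τ t

/-- The kernel `K(s, t | T)`. -/
noncomputable def kernelK (S : ℝ → Vec n →L[ℝ] Vec n) (Φ : ℝ → ℝ → Vec n →L[ℝ] Vec n)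
    (s t : D.Time) : Vec n →L[ℝ] Vec n :=
  Φ s D.t₀ ∘L posSqrt D.Pi0
      ∘L (ContinuousLinearMap.id ℝ (Vec n)
          + posSqrt D.Pi0 ∘L S D.t₀ ∘L posSqrt D.Pi0).inverse
      ∘L posSqrt D.Pi0 ∘L (Φ t D.t₀).adjoint
    + ∫ τ in D.t₀..min (s : ℝ) (t : ℝ), Φ s τ ∘L D.GQG τ ∘L (Φ t τ).adjoint

/-- The set `V` of trajectories, with pointwise operations and with the inner product given by the
cost form on representatives (so with squared norm `J_x`), is a vector-valued reproducing kernel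
Hilbert space with reproducing kernel `K`. The type `E` is `V` itself, through the injective linear
map (part of `RKHS`) sending an element of `E` to the function it is. -/
def IsTrajectoryRKHS (V : Set (D.Time → Vec n)) (K : D.Time → D.Time → Vec n →L[ℝ] Vec n) :
    Prop :=
  ∃ (E : Type) (_ : NormedAddCommGroup E) (_ : InnerProductSpace ℝ E) (_ : CompleteSpace E)
    (_ : RKHS ℝ E D.Time (Vec n)),
    Set.range (fun x : E => (x : D.Time → Vec n)) = V ∧
    (∀ (x y : E) (ξ₁ ξ₂ : Vec n) (u₁ u₂ : ℝ → Vec p),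
      D.IsRepresentative ξ₁ u₁ x → D.IsRepresentative ξ₂ u₂ y →
      inner ℝ x y = D.costForm ξ₁ u₁ x ξ₂ u₂ y) ∧
    (∀ (x : E) (ξ : Vec n) (u : ℝ → Vec p),
      D.IsRepresentative ξ u x → ‖x‖ ^ 2 = D.cost ξ u x) ∧
    RKHS.kernel E = Matrix.of K

end LQData

/-! The nonlinear Riccati equation is solved through a linear one. The Hamiltonian system X' = FX -
GQG*Y, Y' = -H*R⁻¹HX - F*Y with terminal value (Id, Σ_T) has a solution on the whole interval. Along
it, the energy ⟨Xv, Yv⟩ at time t equals ⟨v, Σ_T v⟩ plus the integral over [t, T] of the nonnegative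
quantity ‖(GQ^{1/2})*Yv‖² + ⟨H*R⁻¹HXv, Xv⟩. If X(t)v = 0, the energy vanishes at t, so the coupling
GQG*Yv vanishes on [t, T], Xv solves x' = Fx there with zero initial value, and v = X(T)v = 0. Hence
X is invertible (`IsHamiltonian.isUnit`) and Σ = YX⁻¹ is a global solution, symmetric because X*Y -
Y*X is conserved, positive because the energy is (`Regular.exists_isClosedLoop`). Moreover X is a
fundamental matrix of the closed loop, so Φ(s, t) = X(s)X(t)⁻¹.

Variation of constants gives a bounded linear map L from the Hilbert space of pairs (ξ, u) to
trajectories (`Regular.exists_trajMap`). Representatives are exactly the elements of (ker L)ᗮ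
(`isRepresentative_iff`), a Hilbert space on which L is injective. The state part of the cost is a
bounded positive form, so adding it to the inner product gives an equivalent norm
(`exists_rkhs_inner_add`).

It remains to identify the kernel. The section K(·, t|T)z is the trajectory of the feedback control
(GQ^{1/2})*(q - Σκ), where κ is the section itself and q is the costate Φ(t, ·)*z cut off after t.
Integrating the derivatives of ⟨Σκ, x⟩ and of the costate paired with x gives the reproducing
identity (`IsClosedLoop.reproducing`). Applied to pairs in ker L, this identity also shows that the
control has minimal norm. -/

/-! ### Calculus of absolutely continuous functions and linear Carathéodory equations. -/

section Primitives

variable {E F G : Type*} [NormedAddCommGroup E] [NormedSpace ℝ E]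
  [NormedAddCommGroup F] [NormedSpace ℝ F] [NormedAddCommGroup G] [NormedSpace ℝ G]
  {a b : ℝ}

/-- `x` is absolutely continuous on `[a, b]` with integrable derivative `f`, i.e. `x` is a primitive
of `f`. -/
def IsPrimitiveOn (a b : ℝ) (x f : ℝ → E) : Prop :=
  IntegrableOn f (Icc a b) ∧ ∀ t ∈ Icc a b, x t = x a + ∫ τ in a..t, f τ

theorem MeasureTheory.IntegrableOn.intervalIntegrable_of_mem {E : Type*} [NormedAddCommGroup E]
    {a b : ℝ} {f : ℝ → E}
    (hf : IntegrableOn f (Icc a b)) {s t : ℝ} (hs : s ∈ Icc a b) (ht : t ∈ Icc a b) :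
    IntervalIntegrable f volume s t :=
  (hf.mono_set (uIcc_subset_Icc hs ht)).intervalIntegrable

namespace IsPrimitiveOn

theorem sub_eq_integral {x f : ℝ → E} (hx : IsPrimitiveOn a b x f) {s t : ℝ}
    (hs : s ∈ Icc a b) (ht : t ∈ Icc a b) : x t - x s = ∫ τ in s..t, f τ := by
  have ha : a ∈ Icc a b := left_mem_Icc.2 (hs.1.trans hs.2)
  rw [hx.2 t ht, hx.2 s hs, add_sub_add_left_eq_sub,
    intervalIntegral.integral_interval_sub_left (hx.1.intervalIntegrable_of_mem ha ht)
      (hx.1.intervalIntegrable_of_mem ha hs)]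

theorem eq_add_integral {x f : ℝ → E} (hx : IsPrimitiveOn a b x f) {s t : ℝ}
    (hs : s ∈ Icc a b) (ht : t ∈ Icc a b) : x t = x s + ∫ τ in s..t, f τ := by
  rw [← hx.sub_eq_integral hs ht]; abel

theorem of_eq_add_integral {x f : ℝ → E} (hf : IntegrableOn f (Icc a b)) {c : ℝ} (hc : c ∈ Icc a b)
    (y : E) (h : ∀ t ∈ Icc a b, x t = y + ∫ τ in c..t, f τ) : IsPrimitiveOn a b x f := by
  have ha : a ∈ Icc a b := left_mem_Icc.2 (hc.1.trans hc.2)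
  refine ⟨hf, fun t ht => ?_⟩
  rw [h t ht, h a ha, add_assoc, intervalIntegral.integral_add_adjacent_intervals
    (hf.intervalIntegrable_of_mem hc ha) (hf.intervalIntegrable_of_mem ha ht)]

theorem continuousOn {x f : ℝ → E} (hx : IsPrimitiveOn a b x f) : ContinuousOn x (Icc a b) := by
  have h : ContinuousOn (fun t => x a + ∫ τ in Ioc a t, f τ) (Icc a b) :=
    continuousOn_const.add (intervalIntegral.continuousOn_primitive hx.1)
  refine h.congr fun t ht => ?_
  rw [hx.2 t ht, intervalIntegral.integral_of_le ht.1]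

theorem congr {x y f g : ℝ → E} (hx : IsPrimitiveOn a b x f) (hxy : EqOn y x (Icc a b))
    (hfg : ∀ᵐ t ∂volume.restrict (Icc a b), g t = f t) : IsPrimitiveOn a b y g := by
  refine ⟨hx.1.congr_fun_ae (by filter_upwards [hfg] with t h; exact h.symm), fun t ht => ?_⟩
  have ha : a ∈ Icc a b := left_mem_Icc.2 (ht.1.trans ht.2)
  rw [hxy ht, hxy ha, hx.2 t ht, intervalIntegral.integral_of_le ht.1,
    intervalIntegral.integral_of_le ht.1]
  congr 1
  symm
  have hsub : Ioc a t ⊆ Icc a b := fun τ hτ => ⟨hτ.1.le, hτ.2.trans ht.2⟩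
  refine integral_congr_ae (ae_restrict_of_ae_restrict_of_subset hsub ?_)
  exact hfg

theorem const (c : E) : IsPrimitiveOn a b (fun _ => c) (fun _ => 0) :=
  ⟨integrableOn_zero, fun t _ => by simp⟩

theorem add {x y f g : ℝ → E} (hx : IsPrimitiveOn a b x f) (hy : IsPrimitiveOn a b y g) :
    IsPrimitiveOn a b (fun t => x t + y t) (fun t => f t + g t) := by
  refine ⟨hx.1.add hy.1, fun t ht => ?_⟩
  have ha : a ∈ Icc a b := left_mem_Icc.2 (ht.1.trans ht.2)
  beta_reduce
  rw [intervalIntegral.integral_add (hx.1.intervalIntegrable_of_mem ha ht)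
    (hy.1.intervalIntegrable_of_mem ha ht), hx.2 t ht, hy.2 t ht]
  abel

theorem neg {x f : ℝ → E} (hx : IsPrimitiveOn a b x f) :
    IsPrimitiveOn a b (fun t => -x t) (fun t => -f t) := by
  refine ⟨hx.1.neg, fun t ht => ?_⟩
  beta_reduce
  rw [intervalIntegral.integral_neg, hx.2 t ht]
  abel

theorem sub {x y f g : ℝ → E} (hx : IsPrimitiveOn a b x f) (hy : IsPrimitiveOn a b y g) :
    IsPrimitiveOn a b (fun t => x t - y t) (fun t => f t - g t) := by
  simpa only [sub_eq_add_neg] using hx.add hy.neg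

theorem of_integrableOn {f : ℝ → E} (hf : IntegrableOn f (Icc a b)) (c : E) :
    IsPrimitiveOn a b (fun t => c + ∫ τ in a..t, f τ) f :=
  ⟨hf, fun t _ => by simp⟩

theorem clm [CompleteSpace E] [CompleteSpace F] {x f : ℝ → E} (L : E →L[ℝ] F)
    (hx : IsPrimitiveOn a b x f) : IsPrimitiveOn a b (fun t => L (x t)) (fun t => L (f t)) := by
  refine ⟨L.integrable_comp hx.1, fun t ht => ?_⟩
  have ha : a ∈ Icc a b := left_mem_Icc.2 (ht.1.trans ht.2)
  beta_reduce
  rw [hx.2 t ht, map_add, L.intervalIntegral_comp_comm (hx.1.intervalIntegrable_of_mem ha ht)]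

theorem eq_of_ae_zero {x f : ℝ → E} (hx : IsPrimitiveOn a b x f)
    (hf : f =ᵐ[volume.restrict (Icc a b)] 0) {s t : ℝ} (hs : s ∈ Icc a b)
    (ht : t ∈ Icc a b) : x t = x s := by
  have h := hx.congr (fun _ _ => rfl) (g := fun _ => 0)
    (by filter_upwards [hf] with _ h using h.symm)
  simpa using h.eq_add_integral hs ht

theorem mono {x f : ℝ → E} (hx : IsPrimitiveOn a b x f) {c d : ℝ} (hc : a ≤ c) (hcd : c ≤ d)
    (hd : d ≤ b) : IsPrimitiveOn c d x f :=
  ⟨hx.1.mono_set (Icc_subset_Icc hc hd), fun _ ht =>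
    hx.eq_add_integral ⟨hc, hcd.trans hd⟩ ⟨hc.trans ht.1, ht.2.trans hd⟩⟩

theorem ae_hasDerivAt [CompleteSpace E] {x f : ℝ → E} (hx : IsPrimitiveOn a b x f) :
    ∀ᵐ t, t ∈ Ioo a b → HasDerivAt x (f t) t := by
  rcases le_or_gt b a with h | hab
  · simp [Ioo_eq_empty_of_le h]
  have ha := left_mem_Icc.2 hab.le
  have hi := hx.1.intervalIntegrable_of_mem ha (right_mem_Icc.2 hab.le)
  filter_upwards [hi.ae_hasDerivAt_integral] with t h ht
  have h1 := h (by rw [uIcc_of_le hab.le]; exact Ioo_subset_Icc_self ht) a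
    (by rw [uIcc_of_le hab.le]; exact ha)
  refine (h1.const_add (x a)).congr_of_eventuallyEq ?_
  filter_upwards [Icc_mem_nhds ht.1 ht.2] with s hs using hx.2 s hs

theorem dist_le_integral {x f : ℝ → E} (hx : IsPrimitiveOn a b x f) {s t : ℝ}
    (hs : s ∈ Icc a b) (ht : t ∈ Icc a b) :
    dist (x s) (x t) ≤ dist (∫ τ in a..s, ‖f τ‖) (∫ τ in a..t, ‖f τ‖) := by
  have ha : a ∈ Icc a b := left_mem_Icc.2 (hs.1.trans hs.2)
  have hn : IntegrableOn (fun τ => ‖f τ‖) (Icc a b) := hx.1.norm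
  rw [dist_eq_norm, hx.sub_eq_integral ht hs, Real.dist_eq,
    intervalIntegral.integral_interval_sub_left (hn.intervalIntegrable_of_mem ha hs)
      (hn.intervalIntegrable_of_mem ha ht)]
  exact intervalIntegral.norm_integral_le_abs_integral_norm

end IsPrimitiveOn

/-- Each sum of increments of `x` is dominated by that of `A`. This reduces absolute continuity of
vector-valued functions to that of scalar primitives. -/
theorem AbsolutelyContinuousOnInterval.of_dist_le {E : Type*} [NormedAddCommGroup E] {a b : ℝ}
    {x : ℝ → E} {A : ℝ → ℝ}
    (hA : AbsolutelyContinuousOnInterval A a b)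
    (h : ∀ s ∈ uIcc a b, ∀ t ∈ uIcc a b, dist (x s) (x t) ≤ dist (A s) (A t)) :
    AbsolutelyContinuousOnInterval x a b := by
  unfold AbsolutelyContinuousOnInterval at hA ⊢
  refine squeeze_zero' (.of_forall fun _ => Finset.sum_nonneg fun i _ => dist_nonneg) ?_ hA
  rw [Filter.eventually_inf_principal]
  refine .of_forall fun ⟨n, I⟩ hnI => Finset.sum_le_sum fun i hi => ?_
  simp only [AbsolutelyContinuousOnInterval.disjWithin, mem_ofPred_eq] at hnI
  exact h _ (hnI.1 i hi).1 _ (hnI.1 i hi).2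

theorem ContinuousLinearMap.integrableOn_bilin_left (B : E →L[ℝ] F →L[ℝ] G) {x : ℝ → E} {g : ℝ → F}
    (hx : ContinuousOn x (Icc a b)) (hg : IntegrableOn g (Icc a b)) :
    IntegrableOn (fun t => B (x t) (g t)) (Icc a b) := by
  obtain ⟨C, hC⟩ := isCompact_Icc.exists_bound_of_continuousOn hx
  refine Integrable.mono' (g := fun t => ‖B‖ * C * ‖g t‖) (hg.norm.const_mul _)
    (B.aestronglyMeasurable_comp₂ (hx.aestronglyMeasurable measurableSet_Icc) hg.1) ?_
  filter_upwards [ae_restrict_mem measurableSet_Icc] with t ht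
  refine (B.le_opNorm₂ _ _).trans ?_
  gcongr
  exact hC t ht

theorem ContinuousLinearMap.integrableOn_bilin_right (B : E →L[ℝ] F →L[ℝ] G) {f : ℝ → E} {y : ℝ → F}
    (hf : IntegrableOn f (Icc a b)) (hy : ContinuousOn y (Icc a b)) :
    IntegrableOn (fun t => B (f t) (y t)) (Icc a b) :=
  B.flip.integrableOn_bilin_left hy hf

/-- The product rule for absolutely continuous functions. -/
theorem IsPrimitiveOn.bilin [CompleteSpace E] [CompleteSpace F] [CompleteSpace G]
    (B : E →L[ℝ] F →L[ℝ] G) {x f : ℝ → E} {y g : ℝ → F} (hx : IsPrimitiveOn a b x f)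
    (hy : IsPrimitiveOn a b y g) :
    IsPrimitiveOn a b (fun t => B (x t) (y t)) (fun t => B (x t) (g t) + B (f t) (y t)) := by
  have hint : IntegrableOn (fun t => B (x t) (g t) + B (f t) (y t)) (Icc a b) :=
    (B.integrableOn_bilin_left hx.continuousOn hy.1).add
      (B.integrableOn_bilin_right hx.1 hy.continuousOn)
  refine ⟨hint, fun t ht => ?_⟩
  have hab : a ≤ b := ht.1.trans ht.2
  have ha : a ∈ Icc a b := left_mem_Icc.2 hab
  obtain ⟨C, hC⟩ := isCompact_Icc.exists_bound_of_continuousOn hx.continuousOn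
  obtain ⟨C', hC'⟩ := isCompact_Icc.exists_bound_of_continuousOn hy.continuousOn
  have hC0 : 0 ≤ C := (norm_nonneg _).trans (hC a ha)
  have hC0' : 0 ≤ C' := (norm_nonneg _).trans (hC' a ha)
  -- The defect in the product rule; it is shown to be absolutely continuous with derivative zero
  -- almost everywhere, hence constant.
  set z : ℝ → G := fun t => B (x t) (y t) - ∫ τ in a..t, (B (x τ) (g τ) + B (f τ) (y τ)) with hz
  have hZ := IsPrimitiveOn.of_integrableOn hint 0
  have hac : ∀ {k : ℝ → ℝ}, IntegrableOn k (Icc a b) →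
      AbsolutelyContinuousOnInterval (fun s => ∫ τ in a..s, k τ) a b := fun hk =>
    (hk.intervalIntegrable_of_mem ha
      (right_mem_Icc.2 hab)).absolutelyContinuousOnInterval_intervalIntegral (by simp)
  have hmono : ∀ {k : ℝ → ℝ}, IntegrableOn k (Icc a b) → (∀ s, 0 ≤ k s) →
      ∀ s ∈ Icc a b, ∀ t ∈ Icc a b, s ≤ t →
      dist (∫ τ in a..s, k τ) (∫ τ in a..t, k τ) = ∫ τ in s..t, k τ := by
    intro k hk h0 s hs t ht hst
    rw [dist_comm, Real.dist_eq, intervalIntegral.integral_interval_sub_left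
      (hk.intervalIntegrable_of_mem ha ht) (hk.intervalIntegrable_of_mem ha hs),
      abs_of_nonneg (intervalIntegral.integral_nonneg hst fun u _ => h0 u)]
  -- With `C` and `C'` bounding `x` and `y`, increments of the product are dominated by those of a
  -- primitive of `‖B‖ (C ‖g‖ + C' ‖f‖)`.
  have hB : AbsolutelyContinuousOnInterval (fun t => B (x t) (y t)) a b := by
    refine AbsolutelyContinuousOnInterval.of_dist_le
      (hac (k := fun τ => ‖B‖ * C * ‖g τ‖ + ‖B‖ * C' * ‖f τ‖)
        ((hy.1.norm.const_mul _).add (hx.1.norm.const_mul _))) ?_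
    rw [uIcc_of_le hab]
    have key : ∀ s ∈ Icc a b, ∀ t ∈ Icc a b, s ≤ t → dist (B (x s) (y s)) (B (x t) (y t)) ≤
        dist (∫ τ in a..s, ‖B‖ * C * ‖g τ‖ + ‖B‖ * C' * ‖f τ‖)
          (∫ τ in a..t, ‖B‖ * C * ‖g τ‖ + ‖B‖ * C' * ‖f τ‖) := by
      intro s hs t ht hst
      rw [hmono (k := fun τ => ‖B‖ * C * ‖g τ‖ + ‖B‖ * C' * ‖f τ‖)
        ((hy.1.norm.const_mul _).add (hx.1.norm.const_mul _)) (fun s => by positivity)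
        s hs t ht hst, intervalIntegral.integral_add
          ((hy.1.intervalIntegrable_of_mem hs ht).norm.const_mul _)
          ((hx.1.intervalIntegrable_of_mem hs ht).norm.const_mul _),
        intervalIntegral.integral_const_mul, intervalIntegral.integral_const_mul]
      have e : B (x t) (y t) - B (x s) (y s) = B (x t) (y t - y s) + B (x t - x s) (y s) := by
        simp
      rw [dist_comm, dist_eq_norm, e, hy.sub_eq_integral hs ht, hx.sub_eq_integral hs ht]
      refine (norm_add_le _ _).trans (add_le_add ?_ ?_)
      · refine (B.le_opNorm₂ _ _).trans ?_
        gcongr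
        · exact hC t ht
        · exact intervalIntegral.norm_integral_le_integral_norm hst
      · refine (B.le_opNorm₂ _ _).trans ?_
        rw [mul_assoc, mul_assoc, mul_comm C']
        have h0 := intervalIntegral.norm_integral_le_integral_norm (f := f) (μ := volume) hst
        exact mul_le_mul_of_nonneg_left (mul_le_mul h0 (hC' s hs) (norm_nonneg _)
          ((norm_nonneg _).trans h0)) (norm_nonneg B)
    intro s hs t ht
    rcases le_total s t with h | h
    · exact key s hs t ht h
    · rw [dist_comm, dist_comm (∫ τ in a..s, _)]
      exact key t ht s hs h
  have hI : AbsolutelyContinuousOnInterval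
      (fun t => ∫ τ in a..t, (B (x τ) (g τ) + B (f τ) (y τ))) a b := by
    refine AbsolutelyContinuousOnInterval.of_dist_le (hac hint.norm) ?_
    rw [uIcc_of_le hab]
    intro s hs t ht
    simpa using hZ.dist_le_integral hs ht
  have hzac : AbsolutelyContinuousOnInterval z a b := hB.sub hI
  have hae : ∀ᵐ t, t ∈ uIcc a b → HasDerivAt z 0 t := by
    have hne : ∀ᵐ t : ℝ, t ∉ ({a, b} : Set ℝ) :=
      (Set.toFinite ({a, b} : Set ℝ)).countable.ae_notMem _
    filter_upwards [hx.ae_hasDerivAt, hy.ae_hasDerivAt, hZ.ae_hasDerivAt, hne]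
      with t h1 h2 h3 h4 ht
    rw [uIcc_of_le hab] at ht
    have ht' : t ∈ Ioo a b := ⟨lt_of_le_of_ne ht.1 fun h => h4 (by simp [h]),
      lt_of_le_of_ne ht.2 fun h => h4 (by simp [h])⟩
    have h5 := (B.hasFDerivAt_of_bilinear (h1 ht').hasFDerivAt (h2 ht').hasFDerivAt).hasDerivAt
    have h6 := h5.sub (by simpa using h3 ht')
    simpa using! h6
  obtain ⟨c, hc⟩ := hzac.const_of_ae_hasDerivAt_zero hae
  have h1 := hc t (by rwa [uIcc_of_le hab])
  have h2 := hc a (by simp)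
  simp only [hz, intervalIntegral.integral_same, sub_zero] at h1 h2
  beta_reduce
  rw [h2, ← h1]
  abel

/-- Integrating `k * α ^ n` produces the factor `1 / (n + 1)` behind the factorials in the Picard
iteration. -/
theorem IsPrimitiveOn.pow_succ {α k : ℝ → ℝ} (h : IsPrimitiveOn a b α k) (n : ℕ) :
    IsPrimitiveOn a b (fun t => α t ^ (n + 1)) (fun t => (n + 1) * (k t * α t ^ n)) := by
  induction n with
  | zero => simpa using h
  | succ n ih =>
    convert! ih.bilin (ContinuousLinearMap.mul ℝ ℝ) h using 2 with t t
    · simp only [ContinuousLinearMap.mul_apply', Nat.cast_add, Nat.cast_one]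
      ring

/-- Linear differential equations with integrable coefficients are solvable. -/
theorem exists_isPrimitiveOn_linear [CompleteSpace E] (hab : a ≤ b) {A : ℝ → E →L[ℝ] E}
    (hA : IntegrableOn A (Icc a b)) (e : E) :
    ∃ x : ℝ → E, IsPrimitiveOn a b x (fun t => A t (x t)) ∧ x a = e := by
  have ha : a ∈ Icc a b := left_mem_Icc.2 hab
  have hint : ∀ φ : C(Icc a b, E), IntegrableOn (fun t => A t (IccExtend hab φ t)) (Icc a b) :=
    fun φ => (ContinuousLinearMap.id ℝ (E →L[ℝ] E)).integrableOn_bilin_right hA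
      (φ.continuous.Icc_extend' (h := hab)).continuousOn
  have hprim := fun φ => IsPrimitiveOn.of_integrableOn (hint φ) e
  let next : C(Icc a b, E) → C(Icc a b, E) := fun φ =>
    ⟨fun t => e + ∫ τ in a..(t : ℝ), A τ (IccExtend hab φ τ), (hprim φ).continuousOn.domRestrict⟩
  have hα := IsPrimitiveOn.of_integrableOn hA.norm 0
  simp only [zero_add] at hα
  set α : ℝ → ℝ := fun t => ∫ τ in a..t, ‖A τ‖ with hαdef
  have hα0 : ∀ t ∈ Icc a b, 0 ≤ α t := fun t ht =>
    intervalIntegral.integral_nonneg ht.1 fun _ _ => norm_nonneg _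
  have hαb : ∀ t ∈ Icc a b, α t ≤ α b := fun t ht => by
    have := hα.sub_eq_integral ht (right_mem_Icc.2 hab)
    have h0 : 0 ≤ ∫ τ in t..b, ‖A τ‖ :=
      intervalIntegral.integral_nonneg ht.2 fun _ _ => norm_nonneg _
    linarith
  -- One Picard step need not contract on the whole interval, but the k-th iterate gains `α ^ k /
  -- k!`, where `α` is the primitive of `‖A‖`.
  have hbound : ∀ (k : ℕ) (φ ψ : C(Icc a b, E)) (t : Icc a b),
      ‖(next^[k] φ) t - (next^[k] ψ) t‖ ≤ α t ^ k / (k.factorial : ℝ) * dist φ ψ := by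
    intro k φ ψ
    induction k with
    | zero => intro t; simpa [dist_eq_norm] using ContinuousMap.dist_apply_le_dist (f := φ) (g := ψ) t
    | succ k ih =>
      rintro ⟨t, ht⟩
      rw [Function.iterate_succ_apply', Function.iterate_succ_apply']
      set φ' := next^[k] φ
      set ψ' := next^[k] ψ
      have e1 : (next φ') ⟨t, ht⟩ - (next ψ') ⟨t, ht⟩
          = ∫ τ in a..t, A τ (IccExtend hab φ' τ - IccExtend hab ψ' τ) := by
        simp only [map_sub]
        rw [intervalIntegral.integral_sub ((hint φ').intervalIntegrable_of_mem ha ht)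
          ((hint ψ').intervalIntegrable_of_mem ha ht)]
        exact add_sub_add_left_eq_sub _ _ _
      have hp := hα.pow_succ k
      have e2 : ∫ τ in a..t, ‖A τ‖ * α τ ^ k = α t ^ (k + 1) / (k + 1) := by
        have h1 := hp.2 t ht
        have h2 : α a = 0 := by simp [hαdef]
        simp only [h2, intervalIntegral.integral_const_mul] at h1
        rw [h1]
        have : (k : ℝ) + 1 ≠ 0 := by positivity
        field_simp
        simp
      have hi : IntervalIntegrable (fun τ => ‖A τ‖ * α τ ^ k) volume a t := by
        have : IntegrableOn (fun τ => ‖A τ‖ * α τ ^ k) (Icc a b) :=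
          (ContinuousLinearMap.mul ℝ ℝ).integrableOn_bilin_right hA.norm (hα.continuousOn.pow k)
        exact this.intervalIntegrable_of_mem ha ht
      calc ‖(next φ') ⟨t, ht⟩ - (next ψ') ⟨t, ht⟩‖
          ≤ ∫ τ in a..t, (‖A τ‖ * α τ ^ k) * (dist φ ψ / (k.factorial : ℝ)) := by
            rw [e1]
            refine intervalIntegral.norm_integral_le_of_norm_le ht.1 ?_ (hi.mul_const _)
            refine .of_forall fun τ hτ => ?_
            have hτ' : τ ∈ Icc a b := ⟨hτ.1.le, hτ.2.trans ht.2⟩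
            have := ih ⟨τ, hτ'⟩
            rw [IccExtend_of_mem _ _ hτ', IccExtend_of_mem _ _ hτ']
            refine ((A τ).le_opNorm _).trans ?_
            rw [mul_assoc]
            refine mul_le_mul_of_nonneg_left (this.trans_eq ?_) (norm_nonneg _)
            ring
        _ = α t ^ (k + 1) / ((k + 1).factorial : ℝ) * dist φ ψ := by
            rw [intervalIntegral.integral_mul_const, e2, Nat.factorial_succ]
            push_cast
            field_simp
  obtain ⟨k, hk⟩ := ((FloorSemiring.tendsto_pow_div_factorial_atTop (α b)).eventually
    (gt_mem_nhds one_pos)).exists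
  have hb0 := hα0 b (right_mem_Icc.2 hab)
  have h0 : 0 ≤ α b ^ k / (k.factorial : ℝ) := div_nonneg (pow_nonneg hb0 k) (by positivity)
  have hcon : ContractingWith (α b ^ k / (k.factorial : ℝ)).toNNReal next^[k] := by
    refine ⟨Real.toNNReal_lt_one.2 hk, LipschitzWith.of_dist_le_mul fun φ ψ => ?_⟩
    rw [Real.coe_toNNReal _ h0, ContinuousMap.dist_le (mul_nonneg h0 dist_nonneg)]
    intro t
    rw [dist_eq_norm]
    refine (hbound k φ ψ t).trans ?_
    have h1 := hα0 t t.2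
    have h2 := hαb t t.2
    gcongr
  set φ := hcon.fixedPoint next^[k]
  -- The unique fixed point of a contracting iterate is fixed by the map itself.
  have hφ : next φ = φ := hcon.isFixedPt_fixedPoint_iterate
  have hval : ∀ t ∈ Icc a b, IccExtend hab φ t = e + ∫ τ in a..t, A τ (IccExtend hab φ τ) := by
    intro t ht
    conv_lhs => rw [IccExtend_of_mem _ _ ht, ← hφ]
    rfl
  exact ⟨IccExtend hab φ, (hprim φ).congr hval (.of_forall fun _ => rfl), by rw [hval a ha]; simp⟩

/-- The fundamental solution of a linear differential equation, together with its inverse. -/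
theorem exists_fundamental [FiniteDimensional ℝ E] (hab : a ≤ b) {A : ℝ → E →L[ℝ] E}
    (hA : IntegrableOn A (Icc a b)) :
    ∃ U W : ℝ → E →L[ℝ] E, IsPrimitiveOn a b U (fun t => A t * U t) ∧
      IsPrimitiveOn a b W (fun t => -(W t * A t)) ∧
      ∀ t ∈ Icc a b, W t * U t = 1 ∧ U t * W t = 1 := by
  have : CompleteSpace E := FiniteDimensional.complete ℝ E
  let B := ContinuousLinearMap.mul ℝ (E →L[ℝ] E)
  -- `U` and `W` solve linear equations in the operator algebra, by left multiplication by `A` and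
  -- right multiplication by `-A`, so that `W * U` has zero derivative.
  obtain ⟨U, hU, hU1⟩ := exists_isPrimitiveOn_linear hab (B.integrable_comp hA) 1
  obtain ⟨W, hW, hW1⟩ := exists_isPrimitiveOn_linear hab (B.flip.integrable_comp hA).neg 1
  refine ⟨U, W, hU, hW, fun t ht => ?_⟩
  have h1 : W t * U t = 1 := by
    have h := (hW.bilin B hU).eq_of_ae_zero (.of_forall fun t => ?_) (left_mem_Icc.2 hab) ht
    · simpa [B, hU1, hW1] using h
    · simp [B, mul_assoc]
  refine ⟨h1, ?_⟩
  -- In finite dimension a left inverse is also a right inverse.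
  have h2 : (W t : E →ₗ[ℝ] E) * (U t : E →ₗ[ℝ] E) = 1 := by
    ext v; simpa using congr($h1 v)
  rw [mul_eq_one_comm] at h2
  ext v; simpa using congr($h2 v)

end Primitives

/-! ### Inversion of operators and integrability of the coefficients. -/

section Regularity

/-- Inversion is continuous on the open set of units and takes the default value zero elsewhere.
This gives the measurability of `R⁻¹`. -/
theorem measurable_ringInverse {A : Type*} [NormedRing A] [HasSummableGeomSeries A]
    [MeasurableSpace A] [BorelSpace A] : Measurable (Ring.inverse : A → A) := by
  classical
  have h : (Ring.inverse : A → A) = {x : A | IsUnit x}.piecewise Ring.inverse 0 := by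
    ext x
    by_cases hx : IsUnit x
    · simp [piecewise, hx]
    · simp [piecewise, hx]
  rw [h]
  refine ContinuousOn.measurable_piecewise ?_ continuous_zero.continuousOn
    Units.isOpen.measurableSet
  rintro _ ⟨u, rfl⟩
  exact (NormedRing.inverse_continuousAt u).continuousWithinAt

theorem ContinuousLinearMap.isUnit_of_injective {E : Type*} [NormedAddCommGroup E]
    [NormedSpace ℝ E] [FiniteDimensional ℝ E] (f : E →L[ℝ] E) (hf : Function.Injective f) :
    IsUnit f := by
  have : CompleteSpace E := FiniteDimensional.complete ℝ E
  exact isUnit_iff_bijective.2 ⟨hf, (LinearMap.injective_iff_surjective (f := f.toLinearMap)).1 hf⟩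

theorem ContinuousLinearMap.inverse_comp_of_isUnit {E : Type*} [NormedAddCommGroup E]
    [NormedSpace ℝ E] {f : E →L[ℝ] E} (hf : IsUnit f) : f.inverse ∘L f = .id ℝ E := by
  rw [← ringInverse_eq_inverse]
  exact Ring.inverse_mul_cancel f hf

theorem ContinuousLinearMap.comp_inverse_of_isUnit {E : Type*} [NormedAddCommGroup E]
    [NormedSpace ℝ E] {f : E →L[ℝ] E} (hf : IsUnit f) : f ∘L f.inverse = .id ℝ E := by
  rw [← ringInverse_eq_inverse]
  exact Ring.mul_inverse_cancel f hf

/-- An operator bounded below by `r > 0` is invertible, its inverse is positive, and bounded by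
`r⁻¹`. -/
theorem ContinuousLinearMap.inverse_of_sub_smul_id_isPositive {E : Type*} [NormedAddCommGroup E]
    [InnerProductSpace ℝ E] [FiniteDimensional ℝ E] {f : E →L[ℝ] E} {r : ℝ} (hr : 0 < r)
    (hf : (f - r • ContinuousLinearMap.id ℝ E).IsPositive) :
    IsUnit f ∧ f.inverse.IsPositive ∧ ‖f.inverse‖ ≤ r⁻¹ := by
  have : CompleteSpace E := FiniteDimensional.complete ℝ E
  have hf' : f.IsPositive := by
    have h := hf.add ((isPositive_id (𝕜 := ℝ) (E := E)).smul_of_nonneg hr.le)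
    simpa using h
  have hle : ∀ x, r * ‖x‖ ^ 2 ≤ inner ℝ (f x) x := fun x => by
    have := hf.inner_nonneg_left x
    simp only [sub_apply, smul_apply, id_apply, inner_sub_left, inner_smul_left,
      real_inner_self_eq_norm_sq] at this
    simpa using this
  -- Coercivity and Cauchy–Schwarz; this bound gives both injectivity and the estimate of the
  -- inverse.
  have hle' : ∀ x, r * ‖x‖ ≤ ‖f x‖ := fun x => by
    rcases (norm_nonneg x).eq_or_lt with h | h
    · rw [← h, mul_zero]; exact norm_nonneg _
    · have h1 := (hle x).trans (real_inner_le_norm _ _)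
      rw [pow_two, ← mul_assoc] at h1
      exact le_of_mul_le_mul_right h1 h
  have hu : IsUnit f := f.isUnit_of_injective <| by
    refine (injective_iff_map_eq_zero f).2 fun x hx => ?_
    have h := hle' x
    rw [hx, norm_zero] at h
    exact norm_le_zero_iff.1 (nonpos_of_mul_nonpos_right h hr)
  have hinv : ∀ w, f (f.inverse w) = w := fun w => congr($(comp_inverse_of_isUnit hu) w)
  refine ⟨hu, (isPositive_iff _).2 ⟨fun x y => ?_, fun x => ?_⟩, ?_⟩
  · change inner ℝ (f.inverse x) y = inner ℝ x (f.inverse y)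
    conv_lhs => rw [← hinv y]
    conv_rhs => rw [← hinv x]
    exact (hf'.inner_left_eq_inner_right _ _).symm
  · have h := hf'.inner_nonneg_right (f.inverse x)
    rwa [hinv] at h
  · refine opNorm_le_bound _ (by positivity) fun w => ?_
    have h := hle' (f.inverse w)
    rw [hinv] at h
    rwa [inv_mul_eq_div, le_div_iff₀' hr]

end Regularity

namespace LQData

variable {n p m : ℕ} (D : LQData n p m)

/-- The consequences of the integrability and positivity assumptions on the coefficients of the
linear-quadratic problem that enter the analysis. -/
structure Regular : Prop where
  integrable_F : Integrable D.F D.vol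
  memLp_GQhalf : MemLp D.GQhalf 2 D.vol
  integrable_GQG : Integrable D.GQG D.vol
  integrable_HRH : Integrable D.HRH D.vol
  GQG_eq : ∀ᵐ t ∂D.vol, D.GQG t = D.GQhalf t ∘L (D.GQhalf t).adjoint
  HRH_isPositive : ∀ᵐ t ∂D.vol, (D.HRH t).IsPositive
  Pi0_isPositive : D.Pi0.IsPositive
  SigmaT_isPositive : D.SigmaT.IsPositive

variable {D}

theorem memLp_adjoint {k l : ℕ} {A : ℝ → Vec k →L[ℝ] Vec l} {q : ENNReal} {μ : Measure ℝ}
    (hA : MemLp A q μ) : MemLp (fun t => (A t).adjoint) q μ :=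
  hA.of_le ((ContinuousLinearMap.adjoint (𝕜 := ℝ) (E := Vec k)
    (F := Vec l)).continuous.comp_aestronglyMeasurable hA.1) (.of_forall fun _ => by simp)

theorem memLp_comp {j k l : ℕ} {A : ℝ → Vec k →L[ℝ] Vec l} {B : ℝ → Vec j →L[ℝ] Vec k}
    {p q r : ENNReal} [ENNReal.HolderTriple p q r] {μ : Measure ℝ}
    (hA : MemLp A p μ) (hB : MemLp B q μ) : MemLp (fun t => A t ∘L B t) r μ :=
  (ContinuousLinearMap.compL ℝ (Vec j) (Vec k) (Vec l)).memLp_of_bilin r hA hB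

theorem comp_comp_adjoint_eq {k l : ℕ} (G : Vec k →L[ℝ] Vec l) {Q s : Vec k →L[ℝ] Vec k}
    (h : s ∘L s = Q) (hs : s.IsPositive) : G ∘L Q ∘L G.adjoint = (G ∘L s) ∘L (G ∘L s).adjoint := by
  rw [ContinuousLinearMap.adjoint_comp, hs.isSelfAdjoint.adjoint_eq, ← h]
  simp only [ContinuousLinearMap.comp_assoc]

theorem GQG_eq_of_isPositive {t : ℝ} (ht : (D.Q t).IsPositive) :
    D.GQG t = D.GQhalf t ∘L (D.GQhalf t).adjoint :=
  comp_comp_adjoint_eq (D.G t) (posSqrt_comp_self ht) (posSqrt_isPositive (D.Q t))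

theorem memLp_inverse {k : ℕ} {A : ℝ → Vec k →L[ℝ] Vec k} {r : ℝ} {μ : Measure ℝ} (hr : 0 < r)
    (hA : AEStronglyMeasurable A μ)
    (h : ∀ᵐ t ∂μ, (A t - r • ContinuousLinearMap.id ℝ (Vec k)).IsPositive) :
    MemLp (fun t => (A t).inverse) ⊤ μ := by
  refine memLp_top_of_bound ?_ r⁻¹ ?_
  · borelize (Vec k →L[ℝ] Vec k)
    rw [← ContinuousLinearMap.ringInverse_eq_inverse]
    exact (measurable_ringInverse.comp_aemeasurable hA.aemeasurable).aestronglyMeasurable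
  · filter_upwards [h] with t ht
    exact (ContinuousLinearMap.inverse_of_sub_smul_id_isPositive hr ht).2.2

theorem integrable_HRH (hH : MemLp D.H 2 D.vol)
    (hR : MemLp (fun t => (D.R t).inverse) ⊤ D.vol) : Integrable D.HRH D.vol := by
  rw [← memLp_one_iff_integrable]
  unfold HRH
  exact memLp_comp (p := 2) (q := 2) (memLp_adjoint hH) (memLp_comp hR hH)

/-- With N = GQ^{1/2} in L², GQG* = NN* is integrable by Hölder's inequality; likewise H*R⁻¹H, since
R⁻¹ is bounded by 1/r. -/
theorem regular_of_memLp
    (hF : MemLp D.F 1 D.vol) (hGQ : MemLp D.GQhalf 2 D.vol)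
    (hH : MemLp D.H 2 D.vol) (hR : MemLp D.R 2 D.vol)
    (hQpos : ∀ᵐ t ∂D.vol, (D.Q t).IsPositive)
    (hRpos : ∃ r : ℝ, 0 < r ∧
      ∀ᵐ t ∂D.vol, (D.R t - r • ContinuousLinearMap.id ℝ (Vec m)).IsPositive)
    (hPi0 : D.Pi0.IsPositive) (hSigmaT : D.SigmaT.IsPositive) : D.Regular := by
  have hG : ∀ᵐ t ∂D.vol, D.GQG t = D.GQhalf t ∘L (D.GQhalf t).adjoint := by
    filter_upwards [hQpos] with t ht using GQG_eq_of_isPositive ht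
  obtain ⟨r, hr, hRpos⟩ := hRpos
  have hGQG : MemLp (fun t => D.GQhalf t ∘L (D.GQhalf t).adjoint) 1 D.vol :=
    memLp_comp hGQ (memLp_adjoint hGQ)
  refine ⟨memLp_one_iff_integrable.1 hF, hGQ,
    (memLp_one_iff_integrable.1 hGQG).congr (hG.mono fun _ h => h.symm),
    integrable_HRH hH (memLp_inverse hr hR.1 hRpos), hG, ?_, hPi0, hSigmaT⟩
  filter_upwards [hRpos] with t ht
  exact (ContinuousLinearMap.inverse_of_sub_smul_id_isPositive hr ht).2.1.adjoint_conj (D.H t)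

end LQData

/-! ### Product rules for operators, adjoints and inner products. -/

namespace IsPrimitiveOn

variable {E F G : Type*} {a b : ℝ}

section

variable [NormedAddCommGroup E] [NormedSpace ℝ E]
  [NormedAddCommGroup F] [NormedSpace ℝ F] [NormedAddCommGroup G] [NormedSpace ℝ G]
  [CompleteSpace F] [CompleteSpace G]

theorem comp {A A' : ℝ → F →L[ℝ] G} {B B' : ℝ → E →L[ℝ] F} (hA : IsPrimitiveOn a b A A')
    (hB : IsPrimitiveOn a b B B') :
    IsPrimitiveOn a b (fun t => A t ∘L B t) (fun t => A t ∘L B' t + A' t ∘L B t) :=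
  hA.bilin (ContinuousLinearMap.compL ℝ E F G) hB

theorem clm_apply [CompleteSpace E] {A A' : ℝ → E →L[ℝ] F} {x x' : ℝ → E} (hA : IsPrimitiveOn a b A A')
    (hx : IsPrimitiveOn a b x x') :
    IsPrimitiveOn a b (fun t => A t (x t)) (fun t => A t (x' t) + A' t (x t)) :=
  hA.bilin (ContinuousLinearMap.id ℝ (E →L[ℝ] F)) hx

end

section

variable [NormedAddCommGroup E] [InnerProductSpace ℝ E] [CompleteSpace E]
  [NormedAddCommGroup F] [InnerProductSpace ℝ F] [CompleteSpace F]

theorem adjoint {A A' : ℝ → E →L[ℝ] F} (hA : IsPrimitiveOn a b A A') :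
    IsPrimitiveOn a b (fun t => (A t).adjoint) (fun t => (A' t).adjoint) :=
  -- The adjoint is conjugate-linear in general; over ℝ it is repackaged as a linear map so that
  -- `clm` applies.
  hA.clm (LinearMap.mkContinuous
    { toFun := fun A : E →L[ℝ] F => A.adjoint
      map_add' := fun _ _ => map_add _ _ _
      map_smul' := fun c A => by simp } 1 fun A => by simp)

theorem inner {x x' y y' : ℝ → E} (hx : IsPrimitiveOn a b x x') (hy : IsPrimitiveOn a b y y') :
    IsPrimitiveOn a b (fun t => inner ℝ (x t) (y t))
      (fun t => inner ℝ (x t) (y' t) + inner ℝ (x' t) (y t)) :=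
  hx.bilin (innerSL ℝ) hy

end

end IsPrimitiveOn

/-! ### The Hamiltonian system and invertibility of its first component. -/

namespace LQData

variable {n p m : ℕ} {D : LQData n p m}

theorem left_mem (D : LQData n p m) : D.t₀ ∈ Icc D.t₀ D.T := left_mem_Icc.2 D.lt.le

theorem right_mem (D : LQData n p m) : D.T ∈ Icc D.t₀ D.T := right_mem_Icc.2 D.lt.le

/-- The solution `(X, Y)` of the Hamiltonian system with terminal value `(Id, Σ_T)`. -/
structure IsHamiltonian (D : LQData n p m) (X Y : ℝ → Vec n →L[ℝ] Vec n) : Prop where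
  fst : IsPrimitiveOn D.t₀ D.T X (fun t => D.F t ∘L X t - D.GQG t ∘L Y t)
  snd : IsPrimitiveOn D.t₀ D.T Y (fun t => -(D.HRH t ∘L X t + (D.F t).adjoint ∘L Y t))
  fst_final : X D.T = .id ℝ (Vec n)
  snd_final : Y D.T = D.SigmaT

theorem Regular.integrable_adjoint_F (h : D.Regular) :
    Integrable (fun t => (D.F t).adjoint) D.vol :=
  memLp_one_iff_integrable.1 (memLp_adjoint (memLp_one_iff_integrable.2 h.integrable_F))

theorem Regular.exists_isHamiltonian (h : D.Regular) : ∃ X Y, D.IsHamiltonian X Y := by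
  let V := Vec n
  let i1 : V →L[ℝ] V × V := .inl ℝ V V
  let i2 : V →L[ℝ] V × V := .inr ℝ V V
  let p1 : V × V →L[ℝ] V := .fst ℝ V V
  let p2 : V × V →L[ℝ] V := .snd ℝ V V
  -- The block operator with rows (F, -GQG*) and (-H*R⁻¹H, -F*).
  let A : ℝ → V × V →L[ℝ] V × V := fun t =>
    i1 ∘L D.F t ∘L p1 - i1 ∘L D.GQG t ∘L p2 - i2 ∘L D.HRH t ∘L p1 - i2 ∘L (D.F t).adjoint ∘L p2
  have hc : ∀ (i : V →L[ℝ] V × V) (q : V × V →L[ℝ] V) (f : ℝ → V →L[ℝ] V), Integrable f D.vol →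
      Integrable (fun t => i ∘L f t ∘L q) D.vol := fun i q f hf =>
    (ContinuousLinearMap.compL ℝ (V × V) V (V × V) i).integrable_comp
      (((ContinuousLinearMap.compL ℝ (V × V) V V).flip q).integrable_comp hf)
  have hA : IntegrableOn A (Icc D.t₀ D.T) :=
    (((hc i1 p1 _ h.integrable_F).sub (hc i1 p2 _ h.integrable_GQG)).sub
      (hc i2 p1 _ h.integrable_HRH)).sub (hc i2 p2 _ h.integrable_adjoint_F)
  obtain ⟨U, W, hU, -, hUW⟩ := exists_fundamental D.lt.le hA
  -- `W D.T` inverts `U D.T`, so `U t ∘L J` has the prescribed value (Id, Σ_T) at the final time.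
  let J : V →L[ℝ] V × V := W D.T ∘L (ContinuousLinearMap.id ℝ V).prod D.SigmaT
  have hJ : U D.T ∘L J = (ContinuousLinearMap.id ℝ V).prod D.SigmaT := by
    ext1 v
    exact congr($((hUW D.T D.right_mem).2) (v, D.SigmaT v))
  have hL : ∀ q : V × V →L[ℝ] V, IsPrimitiveOn D.t₀ D.T (fun t => q ∘L U t ∘L J)
      (fun t => q ∘L (A t * U t) ∘L J) := fun q =>
    (hU.clm ((ContinuousLinearMap.compL ℝ V (V × V) (V × V)).flip J)).clm
      (ContinuousLinearMap.compL ℝ V (V × V) V q)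
  refine ⟨fun t => p1 ∘L U t ∘L J, fun t => p2 ∘L U t ∘L J, ?_, ?_, ?_, ?_⟩
  · refine (hL p1).congr (fun _ _ => rfl) (.of_forall fun t => ?_)
    ext1 v
    simp [A, i1, i2, p1, p2]
  · refine (hL p2).congr (fun _ _ => rfl) (.of_forall fun t => ?_)
    ext1 v
    simp [A, i1, i2, p1, p2]
    abel
  · beta_reduce
    rw [hJ]
    rfl
  · beta_reduce
    rw [hJ]
    rfl

theorem Regular.ae_isPositive_GQG (h : D.Regular) : ∀ᵐ t ∂D.vol, (D.GQG t).IsPositive := by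
  filter_upwards [h.GQG_eq] with t ht
  rw [ht]
  exact ContinuousLinearMap.isPositive_self_comp_adjoint _

/-- The flow is symplectic: X*Y - Y*X is conserved, and it vanishes at the final time because Σ_T is
symmetric. -/
theorem IsHamiltonian.adjoint_comp_comm {X Y : ℝ → Vec n →L[ℝ] Vec n} (hXY : D.IsHamiltonian X Y)
    (h : D.Regular) {t : ℝ} (ht : t ∈ Icc D.t₀ D.T) :
    (X t).adjoint ∘L Y t = (Y t).adjoint ∘L X t := by
  have h1 := (hXY.fst.adjoint.comp hXY.snd).sub (hXY.snd.adjoint.comp hXY.fst)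
  have h2 := h1.eq_of_ae_zero ?_ D.right_mem ht
  · have h3 : (X D.T).adjoint ∘L Y D.T - (Y D.T).adjoint ∘L X D.T = 0 := by
      rw [hXY.fst_final, hXY.snd_final, h.SigmaT_isPositive.isSelfAdjoint.adjoint_eq]
      ext v
      simp [ContinuousLinearMap.adjoint_id]
    exact sub_eq_zero.1 (h2.trans h3)
  · filter_upwards [h.ae_isPositive_GQG, h.HRH_isPositive] with t h3 h4
    refine ContinuousLinearMap.ext fun v => ?_
    simp only [map_sub, map_neg, map_add, ContinuousLinearMap.adjoint_comp,
      h3.isSelfAdjoint.adjoint_eq, h4.isSelfAdjoint.adjoint_eq,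
      ContinuousLinearMap.adjoint_adjoint]
    simp
    abel

/-- The energy identity: the two terms in F cancel, and GQG* = NN* with N = GQ^{1/2} makes the
coupling term a square. -/
theorem IsHamiltonian.isPrimitiveOn_inner {X Y : ℝ → Vec n →L[ℝ] Vec n} (hXY : D.IsHamiltonian X Y)
    (h : D.Regular) (v : Vec n) :
    IsPrimitiveOn D.t₀ D.T (fun t => inner ℝ (X t v) (Y t v))
      (fun t => -(‖(D.GQhalf t).adjoint (Y t v)‖ ^ 2 + inner ℝ (D.HRH t (X t v)) (X t v))) := by
  have hc := IsPrimitiveOn.const (a := D.t₀) (b := D.T) v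
  refine ((hXY.fst.clm_apply hc).inner (hXY.snd.clm_apply hc)).congr (fun _ _ => rfl) ?_
  filter_upwards [h.GQG_eq] with t ht
  simp only [map_zero, ht, sub_apply, ContinuousLinearMap.comp_apply,
    neg_apply, add_apply, inner_add_right, inner_neg_right,
    inner_sub_left, ContinuousLinearMap.adjoint_inner_right (D.F t), zero_add,
    ← ContinuousLinearMap.adjoint_inner_right (D.GQhalf t), real_inner_self_eq_norm_sq]
  rw [real_inner_comm (D.HRH t (X t v))]
  ring

/-- The energy at t is its nonnegative terminal value plus an integral of nonnegative terms; if it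
is zero, each of these terms vanishes almost everywhere on [t, T]. -/
theorem IsHamiltonian.inner_nonneg {X Y : ℝ → Vec n →L[ℝ] Vec n} (hXY : D.IsHamiltonian X Y)
    (h : D.Regular) (v : Vec n) {t : ℝ} (ht : t ∈ Icc D.t₀ D.T) :
    0 ≤ inner ℝ (X t v) (Y t v) ∧ (inner ℝ (X t v) (Y t v) = 0 →
      ∀ᵐ τ ∂volume.restrict (Icc t D.T), (D.GQhalf τ).adjoint (Y τ v) = 0) := by
  have h1 := (hXY.isPrimitiveOn_inner h v).mono ht.1 ht.2 le_rfl
  have h2 := h1.eq_add_integral (left_mem_Icc.2 ht.2) (right_mem_Icc.2 ht.2)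
  have h3 : 0 ≤ inner ℝ (X D.T v) (Y D.T v) := by
    rw [hXY.fst_final, hXY.snd_final]
    exact h.SigmaT_isPositive.inner_nonneg_right v
  have hpos : 0 ≤ᵐ[volume.restrict (Icc t D.T)] fun τ =>
      ‖(D.GQhalf τ).adjoint (Y τ v)‖ ^ 2 + inner ℝ (D.HRH τ (X τ v)) (X τ v) := by
    filter_upwards [ae_restrict_of_ae_restrict_of_subset (Icc_subset_Icc_left ht.1)
      h.HRH_isPositive] with τ hτ
    exact add_nonneg (by positivity) (hτ.inner_nonneg_left _)
  rw [intervalIntegral.integral_neg, intervalIntegral.integral_of_le ht.2,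
    ← integral_Icc_eq_integral_Ioc] at h2
  have h4 := integral_nonneg_of_ae hpos
  refine ⟨by linarith, fun h0 => ?_⟩
  have h5 := (integral_eq_zero_iff_of_nonneg_ae hpos
    (h1.1.neg.congr (.of_forall fun _ => neg_neg _))).1 (by linarith)
  filter_upwards [h5, ae_restrict_of_ae_restrict_of_subset (Icc_subset_Icc_left ht.1)
      h.HRH_isPositive] with τ h6 hτ
  have h7 := hτ.inner_nonneg_left (X τ v)
  have h8 : ‖(D.GQhalf τ).adjoint (Y τ v)‖ ^ 2 = 0 := by
    simp only [Pi.zero_apply] at h6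
    nlinarith [sq_nonneg ‖(D.GQhalf τ).adjoint (Y τ v)‖]
  simpa using h8

/-- If X(t)v = 0, zero energy removes the coupling on [t, T]. Then Xv solves x' = Fx from the value
zero, and v = X(T)v = 0. -/
theorem IsHamiltonian.isUnit {X Y : ℝ → Vec n →L[ℝ] Vec n} (hXY : D.IsHamiltonian X Y)
    (h : D.Regular) {t : ℝ} (ht : t ∈ Icc D.t₀ D.T) : IsUnit (X t) := by
  refine (X t).isUnit_of_injective ((injective_iff_map_eq_zero _).2 fun v hv => ?_)
  have h0 := (hXY.inner_nonneg h v ht).2 (by simp [hv])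
  obtain ⟨U, W, hU, hW, hUW⟩ := exists_fundamental D.lt.le h.integrable_F
  have h1 := (hW.clm_apply (hXY.fst.clm_apply (.const v))).mono ht.1 ht.2 le_rfl
  have h2 := h1.eq_of_ae_zero ?_ (left_mem_Icc.2 ht.2) (right_mem_Icc.2 ht.2)
  · simp only [hv, map_zero, hXY.fst_final, ContinuousLinearMap.id_apply] at h2
    have h3 := congr($((hUW D.T D.right_mem).2) v)
    simpa [h2] using h3.symm
  · filter_upwards [h0, ae_restrict_of_ae_restrict_of_subset (Icc_subset_Icc_left ht.1)
      h.GQG_eq] with τ h3 h4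
    simp [h4, h3]

end LQData

/-! ### The Riccati equation and the closed-loop evolution family. -/

namespace LQData

variable {n p m : ℕ} {D : LQData n p m}

/-- `S` is a positive semidefinite solution of the Riccati equation, and `X`, `W` are a fundamental
solution of the closed-loop system `F - G Q G^* S` and its inverse. -/
structure IsClosedLoop (D : LQData n p m) (S X W : ℝ → Vec n →L[ℝ] Vec n) : Prop where
  riccati : IsPrimitiveOn D.t₀ D.T S (fun t => -(S t ∘L D.F t + (D.F t).adjoint ∘L S t
    - S t ∘L D.GQG t ∘L S t + D.HRH t))
  final : S D.T = D.SigmaT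
  isPositive : ∀ t ∈ Icc D.t₀ D.T, (S t).IsPositive
  fundamental : IsPrimitiveOn D.t₀ D.T X (fun t => (D.F t - D.GQG t ∘L S t) ∘L X t)
  inverse : IsPrimitiveOn D.t₀ D.T W (fun t => -(W t ∘L (D.F t - D.GQG t ∘L S t)))
  inverse_apply : ∀ t ∈ Icc D.t₀ D.T, ∀ v, W t (X t v) = v
  apply_inverse : ∀ t ∈ Icc D.t₀ D.T, ∀ v, X t (W t v) = v

theorem integrable_comp_right {A B : ℝ → Vec n →L[ℝ] Vec n} (hA : Integrable A D.vol)
    (hB : ContinuousOn B (Icc D.t₀ D.T)) : Integrable (fun t => A t ∘L B t) D.vol :=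
  (ContinuousLinearMap.compL ℝ (Vec n) (Vec n) (Vec n)).integrableOn_bilin_right hA hB

theorem integrable_comp_left {A B : ℝ → Vec n →L[ℝ] Vec n}
    (hA : ContinuousOn A (Icc D.t₀ D.T)) (hB : Integrable B D.vol) :
    Integrable (fun t => A t ∘L B t) D.vol :=
  (ContinuousLinearMap.compL ℝ (Vec n) (Vec n) (Vec n)).integrableOn_bilin_left hA hB

theorem Regular.integrable_closedLoop (h : D.Regular) {S : ℝ → Vec n →L[ℝ] Vec n}
    (hS : ContinuousOn S (Icc D.t₀ D.T)) : Integrable (fun t => D.F t - D.GQG t ∘L S t) D.vol :=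
  h.integrable_F.sub (integrable_comp_right h.integrable_GQG hS)

theorem Regular.exists_isClosedLoop (h : D.Regular) : ∃ S X W, D.IsClosedLoop S X W := by
  obtain ⟨X, Y, hXY⟩ := h.exists_isHamiltonian
  have hXu : ∀ t ∈ Icc D.t₀ D.T, ∀ v, (X t).inverse (X t v) = v := fun t ht v =>
    congr($(ContinuousLinearMap.inverse_comp_of_isUnit (hXY.isUnit h ht)) v)
  have hinv : ContinuousOn (fun t => (X t).inverse) (Icc D.t₀ D.T) := fun t ht => by
    obtain ⟨u, hu⟩ := hXY.isUnit h ht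
    have h1 := NormedRing.inverse_continuousAt u
    rw [hu, ContinuousLinearMap.ringInverse_eq_inverse] at h1
    exact h1.comp_continuousWithinAt (hXY.fst.continuousOn t ht)
  -- At this stage YX⁻¹ is only known to be continuous, which is enough for the closed-loop
  -- coefficient to be integrable.
  let S₀ : ℝ → Vec n →L[ℝ] Vec n := fun t => Y t ∘L (X t).inverse
  have hS₀ : ContinuousOn S₀ (Icc D.t₀ D.T) := hXY.snd.continuousOn.clm_comp hinv
  have hS₀X : ∀ t ∈ Icc D.t₀ D.T, ∀ v, S₀ t (X t v) = Y t v := fun t ht v => by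
    simp only [S₀, ContinuousLinearMap.comp_apply, hXu t ht]
  obtain ⟨U, V, -, hV, hUV⟩ := exists_fundamental D.lt.le (h.integrable_closedLoop hS₀)
  have hmem : ∀ᵐ t ∂D.vol, t ∈ Icc D.t₀ D.T := ae_restrict_mem measurableSet_Icc
  -- `X` solves the closed-loop equation because `S₀ X = Y`, so its product with the inverse
  -- fundamental solution `V` is constant.
  have hVX : ∀ t ∈ Icc D.t₀ D.T, V t ∘L X t = V D.T := fun t ht => by
    have h1 := (hV.comp hXY.fst).eq_of_ae_zero ?_ D.right_mem ht
    · rw [h1, hXY.fst_final, ContinuousLinearMap.comp_id]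
    · filter_upwards [hmem] with t ht
      refine ContinuousLinearMap.ext fun v => ?_
      simp [hS₀X t ht]
  -- This renormalization of `V` is X⁻¹ on the interval, now known to be absolutely continuous;
  -- hence so is YX⁻¹ by the product rule.
  let W : ℝ → Vec n →L[ℝ] Vec n := fun t => U D.T ∘L V t
  have hW : IsPrimitiveOn D.t₀ D.T W (fun t => -(W t ∘L (D.F t - D.GQG t ∘L S₀ t))) := by
    refine (hV.clm (ContinuousLinearMap.compL ℝ (Vec n) (Vec n) (Vec n) (U D.T))).congr
      (fun _ _ => rfl) (.of_forall fun t => ?_)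
    refine ContinuousLinearMap.ext fun v => ?_
    simp [W]
  have hWX : ∀ t ∈ Icc D.t₀ D.T, W t * X t = 1 := fun t ht => by
    change U D.T ∘L (V t ∘L X t) = 1
    rw [hVX t ht]
    exact (hUV D.T D.right_mem).2
  have hWX' : ∀ t ∈ Icc D.t₀ D.T, ∀ v, W t (X t v) = v := fun t ht v => congr($(hWX t ht) v)
  have hXW' : ∀ t ∈ Icc D.t₀ D.T, ∀ v, X t (W t v) = v := fun t ht v => by
    obtain ⟨u, hu⟩ := hXY.isUnit h ht
    have h1 : X t * W t = 1 := by
      have := hWX t ht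
      rw [← hu] at this ⊢
      exact Units.mul_eq_one_iff_inv_eq.2 (Units.mul_eq_one_iff_eq_inv.1 this).symm
    exact congr($h1 v)
  let S : ℝ → Vec n →L[ℝ] Vec n := fun t => Y t ∘L W t
  have hS : ∀ t ∈ Icc D.t₀ D.T, S₀ t = S t := fun t ht => by
    refine ContinuousLinearMap.ext fun v => ?_
    conv_lhs => rw [← hXW' t ht v, hS₀X t ht]
    rfl
  have hSX : ∀ t ∈ Icc D.t₀ D.T, ∀ v, S t (X t v) = Y t v := fun t ht v => by
    simp only [S, ContinuousLinearMap.comp_apply, hWX' t ht]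
  refine ⟨S, X, W, ?_, ?_, fun t ht => ?_, ?_, ?_, hWX', hXW'⟩
  · refine (hXY.snd.comp hW).congr (fun _ _ => rfl) ?_
    filter_upwards [hmem] with t ht
    refine ContinuousLinearMap.ext fun v => ?_
    rw [hS t ht]
    simp [S, hXW' t ht]
    abel
  · refine ContinuousLinearMap.ext fun v => ?_
    have h1 := hSX D.T D.right_mem v
    rwa [hXY.fst_final, hXY.snd_final] at h1
  · have hc : ∀ x y, inner ℝ (Y t x) (X t y) = inner ℝ (X t x) (Y t y) := fun x y => by
      rw [← ContinuousLinearMap.adjoint_inner_right (Y t),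
        ← ContinuousLinearMap.adjoint_inner_right (X t)]
      exact congr(inner ℝ x ($(hXY.adjoint_comp_comm h ht) y)).symm
    refine (ContinuousLinearMap.isPositive_iff _).2 ⟨fun x y => ?_, fun x => ?_⟩
    · have h1 := hc (W t x) (W t y)
      rwa [hXW' t ht, hXW' t ht] at h1
    · have h1 := (hXY.inner_nonneg h (W t x) ht).1
      rw [hXW' t ht, real_inner_comm] at h1
      exact h1
  · refine hXY.fst.congr (fun _ _ => rfl) ?_
    filter_upwards [hmem] with t ht
    refine ContinuousLinearMap.ext fun v => ?_
    simp [hSX t ht]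
  · refine hW.congr (fun _ _ => rfl) ?_
    filter_upwards [hmem] with t ht
    rw [hS t ht]

/-- Continuity of `S` makes the right-hand side integrable, so the integral equation never relies on
the default value of a divergent integral. -/
theorem IsRiccati.isPrimitiveOn (h : D.Regular) {S : ℝ → Vec n →L[ℝ] Vec n} (hS : D.IsRiccati S) :
    IsPrimitiveOn D.t₀ D.T S (fun t => -(S t ∘L D.F t + (D.F t).adjoint ∘L S t
      - S t ∘L D.GQG t ∘L S t + D.HRH t)) := by
  refine IsPrimitiveOn.of_eq_add_integral (c := D.T) (y := D.SigmaT) ?_ D.right_mem fun t ht => ?_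
  · exact ((((integrable_comp_left hS.1 h.integrable_F).add
      (integrable_comp_right h.integrable_adjoint_F hS.1)).sub
      (integrable_comp_left hS.1
        (integrable_comp_right h.integrable_GQG hS.1))).add h.integrable_HRH).neg
  · rw [intervalIntegral.integral_neg, ← intervalIntegral.integral_symm]
    exact hS.2 t ht

theorem IsClosedLoop.isRiccati {S X W : ℝ → Vec n →L[ℝ] Vec n} (hc : D.IsClosedLoop S X W) :
    D.IsRiccati S := by
  refine ⟨hc.riccati.continuousOn, fun t ht => ?_⟩
  have h1 := hc.riccati.eq_add_integral D.right_mem ht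
  rwa [intervalIntegral.integral_neg, ← intervalIntegral.integral_symm, hc.final] at h1

/-- The difference Δ = S' - S satisfies the linear equation Δ' = -(F* - S'GQG*)Δ - Δ(F - GQG*S).
Multiplied by suitable fundamental solutions on both sides it is constant, and it vanishes at the
final time. Symmetry of S' plays no role. -/
theorem IsClosedLoop.eqOn_of_isRiccati (h : D.Regular) {S X W : ℝ → Vec n →L[ℝ] Vec n}
    (hc : D.IsClosedLoop S X W) {S' : ℝ → Vec n →L[ℝ] Vec n} (hS' : D.IsRiccati S') :
    EqOn S' S (Icc D.t₀ D.T) := by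
  intro t ht
  have hA : IntegrableOn (fun t => -((D.F t).adjoint - S' t ∘L D.GQG t)) (Icc D.t₀ D.T) :=
    (h.integrable_adjoint_F.sub (integrable_comp_left hS'.1 h.integrable_GQG)).neg
  obtain ⟨U, Z, -, hZ, hUZ⟩ := exists_fundamental D.lt.le hA
  have h1 := (hZ.comp ((hS'.isPrimitiveOn h).sub hc.riccati)).comp hc.fundamental
  have h2 := h1.eq_of_ae_zero (.of_forall fun t => ?_) D.right_mem ht
  · have h3 : S' D.T - S D.T = 0 := by
      rw [hc.final, hS'.2 D.T D.right_mem]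
      simp
    rw [h3] at h2
    refine ContinuousLinearMap.ext fun v => sub_eq_zero.1 ?_
    have h4 : Z t (S' t v - S t v) = 0 := by
      simpa [hc.apply_inverse t ht] using congr($h2 (W t v))
    have h5 := congr($((hUZ t ht).2) (S' t v - S t v))
    simpa [h4] using h5.symm
  · refine ContinuousLinearMap.ext fun v => ?_
    simp
    abel

theorem IsClosedLoop.isEvolution {S X W : ℝ → Vec n →L[ℝ] Vec n} (hc : D.IsClosedLoop S X W) :
    D.IsEvolution S (fun s t => X s ∘L W t) := by
  intro t ht
  have h1 : IsPrimitiveOn D.t₀ D.T (fun s => X s ∘L W t)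
      (fun τ => (D.F τ - D.GQG τ ∘L S τ) ∘L (X τ ∘L W t)) :=
    hc.fundamental.clm ((ContinuousLinearMap.compL ℝ (Vec n) (Vec n) (Vec n)).flip (W t))
  refine ⟨h1.continuousOn, fun s hs => ?_⟩
  beta_reduce
  rw [h1.eq_add_integral ht hs]
  congr 1
  exact ContinuousLinearMap.ext (hc.apply_inverse t ht)

/-- The product W(s)Φ(s, t) does not depend on s, and at s = t it is W(t). -/
theorem IsClosedLoop.eq_of_isEvolution (h : D.Regular) {S X W : ℝ → Vec n →L[ℝ] Vec n}
    (hc : D.IsClosedLoop S X W) {Φ : ℝ → ℝ → Vec n →L[ℝ] Vec n} (hΦ : D.IsEvolution S Φ) {s t : ℝ}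
    (hs : s ∈ Icc D.t₀ D.T) (ht : t ∈ Icc D.t₀ D.T) : Φ s t = X s ∘L W t := by
  have h1 : IsPrimitiveOn D.t₀ D.T (fun s => Φ s t)
      (fun τ => (D.F τ - D.GQG τ ∘L S τ) ∘L Φ τ t) :=
    IsPrimitiveOn.of_eq_add_integral (integrable_comp_right
      (h.integrable_closedLoop hc.riccati.continuousOn) (hΦ t ht).1) ht _ (hΦ t ht).2
  have h2 := (hc.inverse.comp h1).eq_of_ae_zero (.of_forall fun t => ?_) ht hs
  · have h3 : Φ t t = .id ℝ (Vec n) := by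
      rw [(hΦ t ht).2 t ht]
      simp
    refine ContinuousLinearMap.ext fun v => ?_
    have h4 : W s (Φ s t v) = W t v := by simpa [h3] using congr($h2 v)
    rw [ContinuousLinearMap.comp_apply, ← h4, hc.apply_inverse s hs]
  · refine ContinuousLinearMap.ext fun v => ?_
    simp

end LQData

/-! ### The map from initial values and controls to trajectories. -/

namespace LQData

variable {n p m : ℕ} {D : LQData n p m}

/-- The Hilbert space `ℝⁿ × L²(t₀, T; ℝᵖ)` of initial values and controls. -/
abbrev Ctrl (D : LQData n p m) : Type := WithLp 2 (Vec n × Lp (Vec p) 2 D.vol)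

theorem ext_apply (x : D.Time → Vec n) {t : ℝ} (ht : t ∈ Icc D.t₀ D.T) : D.ext x t = x ⟨t, ht⟩ :=
  IccExtend_of_mem _ _ ht

theorem hasDerivL1_iff {x : D.Time → Vec n} {v : ℝ → Vec n} :
    D.HasDerivL1 x v ↔ IsPrimitiveOn D.t₀ D.T (D.ext x) v := by
  refine and_congr Iff.rfl ⟨fun h t ht => ?_, fun h t => ?_⟩
  · rw [ext_apply x ht, ext_apply x D.left_mem]
    exact h ⟨t, ht⟩
  · have := h t t.2
    rwa [ext_apply x t.2, ext_apply x D.left_mem] at this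

theorem Generates.isPrimitiveOn {ξ : Vec n} {u : ℝ → Vec p} {x : D.Time → Vec n}
    (h : D.Generates ξ u x) :
    IsPrimitiveOn D.t₀ D.T (D.ext x) (fun τ => D.F τ (D.ext x τ) + D.GQhalf τ (u τ)) :=
  hasDerivL1_iff.1 h.2.2

theorem Generates.ext_left {ξ : Vec n} {u : ℝ → Vec p} {x : D.Time → Vec n}
    (h : D.Generates ξ u x) : D.ext x D.t₀ = posSqrt D.Pi0 ξ := by
  rw [ext_apply x D.left_mem]
  exact h.2.1

theorem Generates.unique (hD : D.Regular) {ξ : Vec n} {u v : ℝ → Vec p} {x y : D.Time → Vec n}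
    (huv : u =ᵐ[D.vol] v) (hx : D.Generates ξ u x) (hy : D.Generates ξ v y) : x = y := by
  obtain ⟨U, V, -, hV, hUV⟩ := exists_fundamental D.lt.le hD.integrable_F
  have h1 := hV.clm_apply (hx.isPrimitiveOn.sub hy.isPrimitiveOn)
  ext1 ⟨t, ht⟩
  have h2 := h1.eq_of_ae_zero ?_ D.left_mem ht
  · rw [hx.ext_left, hy.ext_left, sub_self, map_zero] at h2
    have h3 := congr($((hUV t ht).2) (D.ext x t - D.ext y t))
    rw [mul_apply_eq_comp, h2, map_zero, ext_apply x ht, ext_apply y ht] at h3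
    exact sub_eq_zero.1 h3.symm
  · filter_upwards [huv] with t ht
    simp [ht]

/-- The integral over a subinterval is controlled by the `L¹` norm. -/
theorem norm_integral_le_norm (w : Lp (Vec n) 1 D.vol) {t : ℝ} (ht : t ∈ Icc D.t₀ D.T) :
    ‖∫ τ in D.t₀..t, w τ‖ ≤ ‖w‖ := by
  have hw : Integrable w D.vol := L1.integrable_coeFn w
  rw [L1.norm_eq_integral_norm]
  refine (intervalIntegral.norm_integral_le_integral_norm ht.1).trans ?_
  rw [intervalIntegral.integral_of_le ht.1]
  exact setIntegral_mono_set (s := Ioc D.t₀ t) (t := Icc D.t₀ D.T) hw.norm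
    (.of_forall fun _ => norm_nonneg _)
    (LE.le.eventuallyLE fun τ hτ => ⟨hτ.1.le, hτ.2.trans ht.2⟩)

/-- The integral over `[t₀, t]` as a continuous linear form on `L¹`. -/
noncomputable def primitiveCLM (D : LQData n p m) (t : D.Time) : Lp (Vec n) 1 D.vol →L[ℝ] Vec n :=
  LinearMap.mkContinuous
    { toFun := fun w => ∫ τ in D.t₀..(t : ℝ), w τ
      map_add' := fun w z => by
        have hi : ∀ w : Lp (Vec n) 1 D.vol, IntervalIntegrable w volume D.t₀ t := fun w =>
          IntegrableOn.intervalIntegrable_of_mem (L1.integrable_coeFn w) D.left_mem t.2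
        rw [← intervalIntegral.integral_add (hi w) (hi z), intervalIntegral.integral_of_le t.2.1,
          intervalIntegral.integral_of_le t.2.1]
        exact integral_congr_ae (ae_restrict_of_ae_restrict_of_subset
          (t := Icc D.t₀ D.T) (fun τ hτ => ⟨hτ.1.le, hτ.2.trans t.2.2⟩) (Lp.coeFn_add w z))
      map_smul' := fun c w => by
        rw [RingHom.id_apply, ← intervalIntegral.integral_smul, intervalIntegral.integral_of_le t.2.1,
          intervalIntegral.integral_of_le t.2.1]
        exact integral_congr_ae (ae_restrict_of_ae_restrict_of_subset
          (t := Icc D.t₀ D.T) (fun τ hτ => ⟨hτ.1.le, hτ.2.trans t.2.2⟩) (Lp.coeFn_smul c w)) }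
    1 fun w => by simpa using norm_integral_le_norm w t.2

/-- The pair formed by an initial value and a square integrable control. -/
noncomputable def ctrl (ξ : Vec n) {u : ℝ → Vec p} (hu : MemLp u 2 D.vol) : D.Ctrl :=
  WithLp.toLp 2 (ξ, hu.toLp u)

/-- The trajectories depend linearly and continuously, uniformly in time, on the initial value and
the control. -/
theorem Regular.exists_trajMap (h : D.Regular) :
    ∃ L : D.Ctrl →L[ℝ] (D.Time → Vec n), (∃ C, ∀ k t, ‖L k t‖ ≤ C * ‖k‖) ∧
      ∀ ξ u (hu : MemLp u 2 D.vol) x, D.Generates ξ u x ↔ L (ctrl ξ hu) = x := by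
  obtain ⟨U, V, hU, hV, hUV⟩ := exists_fundamental D.lt.le h.integrable_F
  obtain ⟨CU, hCU⟩ := isCompact_Icc.exists_bound_of_continuousOn hU.continuousOn
  have hCU0 : 0 ≤ CU := (norm_nonneg _).trans (hCU _ D.left_mem)
  have hVN : MemLp (fun t => V t ∘L D.GQhalf t) 2 D.vol := by
    obtain ⟨C, hC⟩ := isCompact_Icc.exists_bound_of_continuousOn hV.continuousOn
    have hV' : MemLp V ⊤ D.vol := memLp_top_of_bound
      (hV.continuousOn.aestronglyMeasurable measurableSet_Icc) C
      ((ae_restrict_mem measurableSet_Icc).mono hC)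
    exact memLp_comp hV' h.memLp_GQhalf
  -- Multiplication by VGQ^{1/2}, bounded from L² to L¹ by Hölder's inequality.
  let J : Lp (Vec p) 2 D.vol →L[ℝ] Lp (Vec n) 1 D.vol :=
    (ContinuousLinearMap.id ℝ (Vec p →L[ℝ] Vec n)).holderL D.vol 2 2 1 (hVN.toLp _)
  have hJ : ∀ u (hu : MemLp u 2 D.vol),
      J (hu.toLp u) =ᵐ[D.vol] fun t => V t (D.GQhalf t (u t)) := fun u hu => by
    filter_upwards [ContinuousLinearMap.coeFn_holder
      (r := 1) (ContinuousLinearMap.id ℝ (Vec p →L[ℝ] Vec n)) (hVN.toLp _) (hu.toLp u),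
      hVN.coeFn_toLp, hu.coeFn_toLp] with t h1 h2 h3
    refine h1.trans ?_
    rw [h2, h3]
    rfl
  -- Variation of constants for the open-loop equation.
  let P : D.Time → D.Ctrl →L[ℝ] Vec n := fun t =>
    U t ∘L (V D.t₀ ∘L posSqrt D.Pi0 ∘L WithLp.fstL 2 ℝ _ _
      + D.primitiveCLM t ∘L J ∘L WithLp.sndL 2 ℝ _ _)
  have hbound : ∀ k t, ‖P t k‖ ≤ CU * (‖V D.t₀ ∘L posSqrt D.Pi0‖ + ‖J‖) * ‖k‖ := fun k t => by
    have h1 : ‖k.fst‖ ≤ ‖k‖ := WithLp.norm_fst_le _ k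
    have h2 : ‖k.snd‖ ≤ ‖k‖ := WithLp.norm_snd_le _ k
    have h3 : ‖D.primitiveCLM t (J k.snd)‖ ≤ ‖J‖ * ‖k‖ :=
      (norm_integral_le_norm (J k.snd) t.2).trans ((J.le_opNorm _).trans (by gcongr))
    have h4 : ‖(V D.t₀ ∘L posSqrt D.Pi0) k.fst‖ ≤ ‖V D.t₀ ∘L posSqrt D.Pi0‖ * ‖k‖ :=
      (ContinuousLinearMap.le_opNorm _ _).trans (by gcongr)
    calc ‖P t k‖ = ‖U t ((V D.t₀ ∘L posSqrt D.Pi0) k.fst + D.primitiveCLM t (J k.snd))‖ := rfl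
      _ ≤ CU * (‖V D.t₀ ∘L posSqrt D.Pi0‖ * ‖k‖ + ‖J‖ * ‖k‖) :=
        ((U t).le_opNorm _).trans (mul_le_mul (hCU t t.2)
          ((norm_add_le _ _).trans (add_le_add h4 h3)) (norm_nonneg _) hCU0)
      _ = _ := by ring
  have hgen : ∀ ξ u (hu : MemLp u 2 D.vol),
      D.Generates ξ u (ContinuousLinearMap.pi P (ctrl ξ hu)) := fun ξ u hu => by
    have hint : IntegrableOn (fun t => V t (D.GQhalf t (u t))) (Icc D.t₀ D.T) :=
      (L1.integrable_coeFn (J (hu.toLp u))).congr (hJ u hu)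
    have hP : ∀ t : D.Time, ContinuousLinearMap.pi P (ctrl ξ hu) t
        = U t (V D.t₀ (posSqrt D.Pi0 ξ) + ∫ τ in D.t₀..t, V τ (D.GQhalf τ (u τ))) := fun t => by
      have h1 : D.primitiveCLM t (J (hu.toLp u))
          = ∫ τ in D.t₀..t, V τ (D.GQhalf τ (u τ)) := by
        change ∫ τ in D.t₀..(t : ℝ), J (hu.toLp u) τ = _
        rw [intervalIntegral.integral_of_le t.2.1, intervalIntegral.integral_of_le t.2.1]
        exact integral_congr_ae (ae_restrict_of_ae_restrict_of_subset
          (t := Icc D.t₀ D.T) (fun τ hτ => ⟨hτ.1.le, hτ.2.trans t.2.2⟩) (hJ u hu))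
      rw [← h1]
      rfl
    have hstart : ContinuousLinearMap.pi P (ctrl ξ hu) D.start = posSqrt D.Pi0 ξ := by
      rw [hP]
      have h1 := congr($((hUV _ D.left_mem).2) (posSqrt D.Pi0 ξ))
      simpa [start] using h1
    refine ⟨hu, hstart, hasDerivL1_iff.2 ?_⟩
    refine (hU.clm_apply (IsPrimitiveOn.of_integrableOn hint (V D.t₀ (posSqrt D.Pi0 ξ)))).congr
      (fun t ht => ?_) ?_
    · rw [ext_apply _ ht, hP]
    · filter_upwards [ae_restrict_mem measurableSet_Icc] with t ht
      rw [ext_apply _ ht, hP]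
      have h1 := congr($((hUV t ht).2) (D.GQhalf t (u t)))
      rw [mul_apply_eq_comp] at h1
      rw [h1, add_comm]
      rfl
  refine ⟨ContinuousLinearMap.pi P, ⟨_, hbound⟩, fun ξ u hu x => ⟨fun hx => ?_, fun hx => ?_⟩⟩
  · exact (hgen ξ u hu).unique h (.refl _ _) hx
  · exact hx ▸ hgen ξ u hu

end LQData

/-! ### Adding a bounded positive form to the inner product of a Hilbert space. -/

/-- A copy of the type `H`, to be equipped with another norm. -/
def Renormed (H : Type) : Type := H

namespace Renormed

variable {H : Type}

instance [AddCommGroup H] : AddCommGroup (Renormed H) := inferInstanceAs (AddCommGroup H)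

instance [AddCommGroup H] [Module ℝ H] : Module ℝ (Renormed H) := inferInstanceAs (Module ℝ H)

/-- The identity, as a linear equivalence. -/
def equiv (H : Type) [AddCommGroup H] [Module ℝ H] : H ≃ₗ[ℝ] Renormed H := LinearEquiv.refl ℝ H

end Renormed

/-- A Hilbert space mapped continuously and injectively to a space of functions is a reproducing
kernel Hilbert space, and remains so if a bounded positive semidefinite form is added to its inner
product. -/
theorem exists_rkhs_inner_add {H X V : Type} [NormedAddCommGroup H] [InnerProductSpace ℝ H]
    [CompleteSpace H] [NormedAddCommGroup V] [InnerProductSpace ℝ V] (L : H →L[ℝ] (X → V))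
    (hL : Function.Injective L) (β : H → H → ℝ) (hsymm : ∀ x y, β x y = β y x)
    (hadd : ∀ x y z, β (x + y) z = β x z + β y z) (hsmul : ∀ (c : ℝ) x y, β (c • x) y = c * β x y)
    (hpos : ∀ x, 0 ≤ β x x) (C : ℝ) (hC : ∀ x, β x x ≤ C * ‖x‖ ^ 2) :
    ∃ (E : Type) (_ : NormedAddCommGroup E) (_ : InnerProductSpace ℝ E) (_ : CompleteSpace E)
      (_ : RKHS ℝ E X V) (e : H ≃ₗ[ℝ] E),
      (∀ x y, inner ℝ (e x) (e y) = inner ℝ x y + β x y) ∧ ∀ x, ⇑(e x) = L x := by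
  let e := Renormed.equiv H
  let core : InnerProductSpace.Core ℝ (Renormed H) :=
    { inner := fun x y => inner ℝ (e.symm x) (e.symm y) + β (e.symm x) (e.symm y)
      conj_inner_symm := fun x y => by
        simp only [conj_trivial]
        rw [hsymm, real_inner_comm]
      re_inner_nonneg := fun x => by
        simpa using add_nonneg (real_inner_self_nonneg (x := e.symm x)) (hpos (e.symm x))
      add_left := fun x y z => by
        simp only [map_add, inner_add_left, hadd]
        ring
      smul_left := fun x y c => by
        simp only [map_smul, inner_smul_left, hsmul, conj_trivial]
        ring
      definite := fun x hx => by
        have h1 := real_inner_self_nonneg (x := e.symm x)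
        have h2 := hpos (e.symm x)
        have h3 : inner ℝ (e.symm x) (e.symm x) = (0 : ℝ) := by linarith
        simpa using h3 }
  let _ : NormedAddCommGroup (Renormed H) := core.toNormedAddCommGroup
  let _ : InnerProductSpace ℝ (Renormed H) := InnerProductSpace.ofCore core.toCore
  have hinner : ∀ x y, inner ℝ (e x) (e y) = inner ℝ x y + β x y := fun _ _ => rfl
  have hnorm : ∀ x, ‖e x‖ ^ 2 = ‖x‖ ^ 2 + β x x := fun x => by
    rw [← real_inner_self_eq_norm_sq, ← real_inner_self_eq_norm_sq, hinner]
  -- The norms are equivalent: ‖x‖² ≤ ‖e x‖² ≤ (1 + |C|)‖x‖². The absolute value is there because no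
  -- sign is assumed for `C`.
  let e' : H ≃L[ℝ] Renormed H := e.toContinuousLinearEquivOfBounds (√(1 + |C|)) 1
    (fun x => by
      rw [← Real.sqrt_sq (norm_nonneg x), ← Real.sqrt_mul (by positivity)]
      refine Real.le_sqrt_of_sq_le ?_
      rw [hnorm]
      nlinarith [hC x, le_abs_self C, sq_nonneg ‖x‖])
    (fun y => by
      obtain ⟨x, rfl⟩ := e.surjective y
      rw [e.symm_apply_apply, one_mul]
      refine (pow_le_pow_iff_left₀ (norm_nonneg _) (norm_nonneg _) two_ne_zero).1 ?_
      rw [hnorm]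
      linarith [hpos x])
  have hcomplete : CompleteSpace (Renormed H) :=
    (completeSpace_congr (e := e'.toEquiv) e'.isUniformEmbedding).1 inferInstance
  let _ : RKHS ℝ (Renormed H) X V :=
    { coeCLM := L ∘L (e'.symm : Renormed H →L[ℝ] H)
      coeCLM_injective := hL.comp e'.symm.injective }
  exact ⟨Renormed H, inferInstance, inferInstance, hcomplete, inferInstance, e, hinner,
    fun x => rfl⟩

/-! ### Representatives of minimal norm and the RKHS of trajectories. -/

namespace LQData

variable {n p m : ℕ} {D : LQData n p m}

theorem ctrl_eta (k : D.Ctrl) : ctrl k.fst (Lp.memLp k.snd) = k := by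
  rw [ctrl, Lp.toLp_coeFn]
  rfl

theorem integral_eq_integral_vol {E : Type*} [NormedAddCommGroup E] [NormedSpace ℝ E]
    (D : LQData n p m) (f : ℝ → E) : ∫ t in D.t₀..D.T, f t = ∫ t, f t ∂D.vol := by
  rw [intervalIntegral.integral_of_le D.lt.le, ← integral_Icc_eq_integral_Ioc]
  rfl

theorem inner_ctrl (ξ η : Vec n) {u v : ℝ → Vec p} (hu : MemLp u 2 D.vol) (hv : MemLp v 2 D.vol) :
    inner ℝ (ctrl ξ hu) (ctrl η hv)
      = inner ℝ ξ η + ∫ t in D.t₀..D.T, inner ℝ (u t) (v t) := by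
  rw [WithLp.prod_inner_apply, L2.inner_def, integral_eq_integral_vol]
  congr 1
  refine integral_congr_ae ?_
  filter_upwards [hu.coeFn_toLp, hv.coeFn_toLp] with t h1 h2
  exact congr(inner ℝ $h1 $h2)

theorem norm_sq_ctrl (ξ : Vec n) {u : ℝ → Vec p} (hu : MemLp u 2 D.vol) :
    ‖ctrl ξ hu‖ ^ 2 = (∫ t in D.t₀..D.T, ‖u t‖ ^ 2) + ‖ξ‖ ^ 2 := by
  rw [← real_inner_self_eq_norm_sq, inner_ctrl, real_inner_self_eq_norm_sq, add_comm]
  simp only [real_inner_self_eq_norm_sq]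

/-- `L` is the linear map sending an initial value and a control to the trajectory that they
generate. -/
structure IsTrajMap (L : D.Ctrl →L[ℝ] (D.Time → Vec n)) : Prop where
  bound : ∃ C, ∀ k t, ‖L k t‖ ≤ C * ‖k‖
  generates_iff : ∀ ξ u (hu : MemLp u 2 D.vol) x, D.Generates ξ u x ↔ L (ctrl ξ hu) = x

namespace IsTrajMap

variable {L : D.Ctrl →L[ℝ] (D.Time → Vec n)}

theorem generates (hL : IsTrajMap L) (k : D.Ctrl) : D.Generates k.fst k.snd (L k) :=
  (hL.generates_iff _ _ (Lp.memLp k.snd) _).2 (by rw [ctrl_eta])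

theorem mem_range_iff (hL : IsTrajMap L) {x : D.Time → Vec n} :
    x ∈ D.trajSpace ↔ ∃ k, L k = x :=
  ⟨fun ⟨ξ, u, h⟩ => ⟨ctrl ξ h.1, (hL.generates_iff ξ u h.1 x).1 h⟩,
    fun ⟨k, hk⟩ => ⟨k.fst, k.snd, hk ▸ hL.generates k⟩⟩

/-- The space of controls of minimal norm. -/
noncomputable abbrev minimal (L : D.Ctrl →L[ℝ] (D.Time → Vec n)) : Submodule ℝ D.Ctrl := L.kerᗮ

/-- The orthogonal projection onto the complement of the closed kernel leaves the trajectory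
unchanged, and Pythagoras measures the excess norm. -/
theorem exists_minimal (k : D.Ctrl) :
    ∃ l ∈ minimal L, L l = L k ∧ ‖k‖ ^ 2 = ‖l‖ ^ 2 + ‖k - l‖ ^ 2 := by
  have hcl : IsClosed (L.ker : Set D.Ctrl) := L.isClosed_ker
  have : CompleteSpace L.ker := hcl.completeSpace_coe
  obtain ⟨a, ha, l, hl, rfl⟩ := L.ker.exists_add_mem_mem_orthogonal k
  have ha' : L a = 0 := ha
  refine ⟨l, hl, by rw [map_add, ha', zero_add], ?_⟩
  have h1 : inner ℝ a l = 0 := hl a ha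
  rw [add_sub_cancel_right, norm_add_sq_real, h1]
  ring

theorem injOn_minimal {k l : D.Ctrl} (hk : k ∈ minimal L) (hl : l ∈ minimal L) (h : L k = L l) :
    k = l := by
  have h1 : k - l ∈ L.ker := by
    change L (k - l) = 0
    rw [map_sub, h, sub_self]
  have h2 : inner ℝ (k - l) (k - l) = (0 : ℝ) := (Submodule.sub_mem _ hk hl) _ h1
  exact sub_eq_zero.1 (inner_self_eq_zero.1 h2)

/-- By Pythagoras, a pair is of minimal norm exactly when its kernel component is zero. This linear
description is what makes representatives form a Hilbert space. -/
theorem isRepresentative_iff (hL : IsTrajMap L) {ξ : Vec n} {u : ℝ → Vec p} {x : D.Time → Vec n} :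
    D.IsRepresentative ξ u x ↔
      ∃ hu : MemLp u 2 D.vol, ctrl ξ hu ∈ minimal L ∧ L (ctrl ξ hu) = x := by
  constructor
  · rintro ⟨hx, hmin⟩
    have h1 := (hL.generates_iff ξ u hx.1 x).1 hx
    refine ⟨hx.1, ?_, h1⟩
    obtain ⟨l, hl, hl', hn⟩ := exists_minimal (L := L) (ctrl ξ hx.1)
    have h2 := hmin _ _ (by rw [← h1, ← hl']; exact hL.generates l)
    rw [← norm_sq_ctrl ξ hx.1, ← norm_sq_ctrl l.fst (Lp.memLp l.snd), ctrl_eta] at h2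
    have h3 : ‖ctrl ξ hx.1 - l‖ ^ 2 = 0 := le_antisymm (by linarith) (by positivity)
    have h4 : ctrl ξ hx.1 = l := sub_eq_zero.1 (by simpa using h3)
    rwa [h4]
  · rintro ⟨hu, hmem, rfl⟩
    refine ⟨(hL.generates_iff ξ u hu _).2 rfl, fun ξ' u' h => ?_⟩
    have h1 := (hL.generates_iff ξ' u' h.1 _).1 h
    obtain ⟨l, hl, hl', hn⟩ := exists_minimal (L := L) (ctrl ξ' h.1)
    have h2 := injOn_minimal hmem hl (h1.symm.trans hl'.symm)
    rw [← norm_sq_ctrl ξ hu, ← norm_sq_ctrl ξ' h.1, hn, ← h2]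
    exact le_add_of_nonneg_right (by positivity)

theorem exists_unique_representative (hL : IsTrajMap L) {x : D.Time → Vec n}
    (hx : x ∈ D.trajSpace) :
    ∃ ξ u, D.IsRepresentative ξ u x ∧
      ∀ ξ' u', D.IsRepresentative ξ' u' x → ξ' = ξ ∧ u' =ᵐ[D.vol] u := by
  obtain ⟨k, rfl⟩ := hL.mem_range_iff.1 hx
  obtain ⟨l, hl, hl', -⟩ := exists_minimal (L := L) k
  refine ⟨l.fst, l.snd, hL.isRepresentative_iff.2
    ⟨Lp.memLp l.snd, by rwa [ctrl_eta], by rwa [ctrl_eta]⟩, fun ξ' u' h => ?_⟩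
  obtain ⟨hu', hmem, h1⟩ := hL.isRepresentative_iff.1 h
  have h2 := injOn_minimal hmem hl (h1.trans hl'.symm)
  have h3 : hu'.toLp u' = l.snd := congr(WithLp.snd $h2)
  refine ⟨congr(WithLp.fst $h2), ?_⟩
  rw [← h3]
  exact hu'.coeFn_toLp.symm

end IsTrajMap

/-- The part of the cost form that depends on the trajectories only. -/
noncomputable def stateForm (D : LQData n p m) (x y : D.Time → Vec n) : ℝ :=
  inner ℝ (D.SigmaT (x D.final)) (y D.final)
    + ∫ t in D.t₀..D.T, inner ℝ (D.HRH t (D.ext x t)) (D.ext y t)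

theorem costForm_eq {ξ η : Vec n} {u v : ℝ → Vec p} (hu : MemLp u 2 D.vol) (hv : MemLp v 2 D.vol)
    (x y : D.Time → Vec n) :
    D.costForm ξ u x η v y = inner ℝ (ctrl ξ hu) (ctrl η hv) + D.stateForm x y := by
  rw [inner_ctrl, costForm, stateForm]
  ring

theorem cost_eq_costForm (ξ : Vec n) (u : ℝ → Vec p) (x : D.Time → Vec n) :
    D.cost ξ u x = D.costForm ξ u x ξ u x := by
  simp only [cost, costForm, real_inner_self_eq_norm_sq]

theorem Generates.continuousOn {ξ : Vec n} {u : ℝ → Vec p} {x : D.Time → Vec n}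
    (h : D.Generates ξ u x) : ContinuousOn (D.ext x) (Icc D.t₀ D.T) :=
  h.isPrimitiveOn.continuousOn

theorem Regular.integrable_inner_HRH (h : D.Regular) {x y : ℝ → Vec n}
    (hx : ContinuousOn x (Icc D.t₀ D.T)) (hy : ContinuousOn y (Icc D.t₀ D.T)) :
    IntegrableOn (fun t => inner ℝ (D.HRH t (x t)) (y t)) (Icc D.t₀ D.T) :=
  (innerSL ℝ).integrableOn_bilin_right
    ((ContinuousLinearMap.id ℝ (Vec n →L[ℝ] Vec n)).integrableOn_bilin_right h.integrable_HRH hx) hy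

theorem stateForm_comm (h : D.Regular) (x y : D.Time → Vec n) :
    D.stateForm x y = D.stateForm y x := by
  unfold stateForm
  congr 1
  · rw [h.SigmaT_isPositive.inner_left_eq_inner_right, real_inner_comm]
  · rw [integral_eq_integral_vol, integral_eq_integral_vol]
    refine integral_congr_ae ?_
    filter_upwards [h.HRH_isPositive] with t ht
    rw [ht.inner_left_eq_inner_right, real_inner_comm]

theorem stateForm_self_nonneg (h : D.Regular) (x : D.Time → Vec n) : 0 ≤ D.stateForm x x := by
  refine add_nonneg (h.SigmaT_isPositive.inner_nonneg_left _) ?_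
  rw [integral_eq_integral_vol]
  refine integral_nonneg_of_ae ?_
  filter_upwards [h.HRH_isPositive] with t ht using ht.inner_nonneg_left _

theorem stateForm_add_left (h : D.Regular) {x y z : D.Time → Vec n}
    (hx : ContinuousOn (D.ext x) (Icc D.t₀ D.T)) (hy : ContinuousOn (D.ext y) (Icc D.t₀ D.T))
    (hz : ContinuousOn (D.ext z) (Icc D.t₀ D.T)) :
    D.stateForm (x + y) z = D.stateForm x z + D.stateForm y z := by
  have h1 : ∀ t, D.ext (x + y) t = D.ext x t + D.ext y t := fun t => rfl
  simp only [stateForm, h1, map_add, inner_add_left, Pi.add_apply]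
  rw [intervalIntegral.integral_add
    ((h.integrable_inner_HRH hx hz).intervalIntegrable_of_mem D.left_mem D.right_mem)
    ((h.integrable_inner_HRH hy hz).intervalIntegrable_of_mem D.left_mem D.right_mem)]
  ring

theorem stateForm_smul_left (c : ℝ) (x y : D.Time → Vec n) :
    D.stateForm (c • x) y = c * D.stateForm x y := by
  have h1 : ∀ t, D.ext (c • x) t = c • D.ext x t := fun t => rfl
  simp only [stateForm, h1, map_smul, inner_smul_left, Pi.smul_apply, conj_trivial,
    intervalIntegral.integral_const_mul]
  ring

/-- With `c` proportional to the norm of the control pair, this is the boundedness of the form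
needed for the equivalence of norms. -/
theorem stateForm_self_le (h : D.Regular) {x : D.Time → Vec n}
    {c : ℝ} (hc : ∀ t, ‖x t‖ ≤ c) :
    D.stateForm x x ≤ (‖D.SigmaT‖ + ∫ t in D.t₀..D.T, ‖D.HRH t‖) * c ^ 2 := by
  have key : ∀ (A : Vec n →L[ℝ] Vec n) (v : Vec n), ‖v‖ ≤ c → ‖inner ℝ (A v) v‖ ≤ ‖A‖ * c ^ 2 :=
    fun A v hv => by
      refine (norm_inner_le_norm _ _).trans ?_
      have h0 : 0 ≤ c := (norm_nonneg v).trans hv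
      calc ‖A v‖ * ‖v‖ ≤ (‖A‖ * ‖v‖) * ‖v‖ := by gcongr; exact A.le_opNorm v
        _ ≤ (‖A‖ * c) * c := by gcongr
        _ = ‖A‖ * c ^ 2 := by ring
  rw [add_mul, ← intervalIntegral.integral_mul_const]
  refine add_le_add ((le_abs_self _).trans (key _ _ (hc _))) ((le_abs_self _).trans ?_)
  rw [← Real.norm_eq_abs]
  refine intervalIntegral.norm_integral_le_of_norm_le D.lt.le (.of_forall fun t _ => ?_)
    ((IntegrableOn.intervalIntegrable_of_mem h.integrable_HRH.norm D.left_mem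
      D.right_mem).mul_const _)
  exact key _ _ (hc _)

/-- The trajectories form a reproducing kernel Hilbert space, and its reproducing kernel is
characterized by the reproducing property. -/
theorem IsTrajMap.isTrajectoryRKHS (h : D.Regular) {L : D.Ctrl →L[ℝ] (D.Time → Vec n)}
    (hL : IsTrajMap L) {K : D.Time → D.Time → Vec n →L[ℝ] Vec n}
    (hK : ∀ t z, ∃ k, L k = (fun s => K s t z) ∧
      ∀ l, inner ℝ l k + D.stateForm (L l) (L k) = inner ℝ (L l t) z) :
    D.IsTrajectoryRKHS D.trajSpace K := by
  have hcont : ∀ k, ContinuousOn (D.ext (L k)) (Icc D.t₀ D.T) := fun k =>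
    (hL.generates k).continuousOn
  obtain ⟨C, hC⟩ := hL.bound
  have hcl : CompleteSpace (minimal L) := (Submodule.isClosed_orthogonal _).completeSpace_coe
  obtain ⟨E, i1, i2, i3, i4, e, he, heL⟩ := exists_rkhs_inner_add (L ∘L (minimal L).subtypeL)
    (fun k l hkl => Subtype.ext (injOn_minimal k.2 l.2 hkl))
    (fun k l => D.stateForm (L k) (L l)) (fun k l => stateForm_comm h _ _)
    (fun j k l => by
      rw [Submodule.coe_add, map_add]
      exact stateForm_add_left h (hcont _) (hcont _) (hcont _))
    (fun c k l => by rw [Submodule.coe_smul, map_smul]; exact stateForm_smul_left _ _ _)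
    (fun k => stateForm_self_nonneg h _)
    ((‖D.SigmaT‖ + ∫ t in D.t₀..D.T, ‖D.HRH t‖) * C ^ 2)
    (fun k => (stateForm_self_le h (hC k)).trans_eq (by rw [mul_pow, mul_assoc]; rfl))
  have heL' : ∀ k, ⇑(e k) = L k := heL
  have hrep : ∀ (x : E) (ξ : Vec n) (u : ℝ → Vec p), D.IsRepresentative ξ u x →
      ∃ (hu : MemLp u 2 D.vol) (hk : ctrl ξ hu ∈ minimal L), x = e ⟨ctrl ξ hu, hk⟩ := by
    intro x ξ u hx
    obtain ⟨hu, hk, h1⟩ := hL.isRepresentative_iff.1 hx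
    exact ⟨hu, hk, DFunLike.coe_injective (by rw [heL', ← h1])⟩
  have hform : ∀ (x y : E) (ξ₁ ξ₂ : Vec n) (u₁ u₂ : ℝ → Vec p),
      D.IsRepresentative ξ₁ u₁ x → D.IsRepresentative ξ₂ u₂ y →
      inner ℝ x y = D.costForm ξ₁ u₁ x ξ₂ u₂ y := by
    intro x y ξ₁ ξ₂ u₁ u₂ hx hy
    obtain ⟨hu₁, hk₁, rfl⟩ := hrep x ξ₁ u₁ hx
    obtain ⟨hu₂, hk₂, rfl⟩ := hrep y ξ₂ u₂ hy
    rw [he, costForm_eq hu₁ hu₂, heL', heL']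
    rfl
  refine ⟨E, i1, i2, i3, i4, ?_, hform, fun x ξ u hx => ?_, ?_⟩
  · ext x
    rw [hL.mem_range_iff]
    constructor
    · rintro ⟨y, rfl⟩
      obtain ⟨k, rfl⟩ := e.surjective y
      exact ⟨k, (heL' k).symm⟩
    · rintro ⟨k, rfl⟩
      obtain ⟨l, hl, hl', -⟩ := exists_minimal (L := L) k
      exact ⟨e ⟨l, hl⟩, by rw [← hl']; exact heL' _⟩
  · rw [← real_inner_self_eq_norm_sq, hform x x ξ ξ u u hx hx, cost_eq_costForm]
  · refine Matrix.ext fun s t => ContinuousLinearMap.ext fun z => ?_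
    obtain ⟨k, hk, hrepr⟩ := hK t z
    -- Tested on a pair with zero trajectory, the reproducing identity reduces to orthogonality;
    -- minimality of the generator of the kernel section is thus automatic.
    have hkmem : k ∈ minimal L := fun l hl => by
      have hl0 : L l = 0 := hl
      have h1 := hrepr l
      have h2 : D.stateForm (0 : D.Time → Vec n) (L k) = 0 := by
        have := stateForm_smul_left (D := D) 0 0 (L k)
        simpa using this
      rw [hl0, h2] at h1
      simpa using h1
    have hker : RKHS.kerFun E t z = e ⟨k, hkmem⟩ := by
      refine ext_inner_left ℝ fun y => ?_
      obtain ⟨l, rfl⟩ := e.surjective y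
      rw [RKHS.inner_kerFun, he, heL']
      exact (hrepr l).symm
    rw [← RKHS.kerFun_apply, hker, heL', Matrix.of_apply]
    exact congr($hk s)

end LQData

/-! ### The kernel sections as closed-loop trajectories, and the reproducing identity. -/

theorem intervalIntegral_indicator_Iic {E : Type*} [NormedAddCommGroup E] [NormedSpace ℝ E]
    (f : ℝ → E) {a s t : ℝ} (hs : a ≤ s) (ht : a ≤ t) :
    ∫ τ in a..s, (Iic t).indicator f τ = ∫ τ in a..min s t, f τ := by
  rw [intervalIntegral.integral_of_le hs, intervalIntegral.integral_of_le (le_min hs ht),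
    setIntegral_indicator measurableSet_Iic, Ioc_inter_Iic]

namespace LQData

variable {n p m : ℕ} {D : LQData n p m} {S X W : ℝ → Vec n →L[ℝ] Vec n}

namespace IsClosedLoop

/-- The operator `Id + Π₀^{1/2} Σ(t₀) Π₀^{1/2}` is invertible. -/
theorem apply_inverse_id_add (hc : D.IsClosedLoop S X W) (v : Vec n) :
    let M := ContinuousLinearMap.id ℝ (Vec n) + posSqrt D.Pi0 ∘L S D.t₀ ∘L posSqrt D.Pi0
    M.inverse v + posSqrt D.Pi0 (S D.t₀ (posSqrt D.Pi0 (M.inverse v))) = v := by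
  intro M
  have hs := posSqrt_isPositive D.Pi0
  -- The operator is the identity plus a conjugate of the positive Σ(t₀), hence bounded below by 1.
  have h1 : (M - (1 : ℝ) • ContinuousLinearMap.id ℝ (Vec n)).IsPositive := by
    have h2 := (hc.isPositive _ D.left_mem).conj_adjoint (posSqrt D.Pi0)
    rw [hs.isSelfAdjoint.adjoint_eq] at h2
    rwa [one_smul, add_sub_cancel_left]
  exact congr($(ContinuousLinearMap.comp_inverse_of_isUnit
    (ContinuousLinearMap.inverse_of_sub_smul_id_isPositive one_pos h1).1) v)

/-- The costate `τ ↦ Φ(t, τ)^* z`. -/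
theorem costate_isPrimitiveOn (hc : D.IsClosedLoop S X W) (y : Vec n) :
    IsPrimitiveOn D.t₀ D.T (fun τ => (W τ).adjoint y)
      (fun τ => -(D.F τ - D.GQG τ ∘L S τ).adjoint ((W τ).adjoint y)) := by
  refine (hc.inverse.adjoint.clm_apply (.const y)).congr (fun _ _ => rfl) (.of_forall fun τ => ?_)
  rw [map_neg, ContinuousLinearMap.adjoint_comp, map_zero, zero_add]
  rfl

variable (D S X W) in
/-- The initial parameter of the kernel function `K(·, t | T) z`. -/
noncomputable def kernelParam (t : D.Time) (z : Vec n) : Vec n :=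
  (ContinuousLinearMap.id ℝ (Vec n) + posSqrt D.Pi0 ∘L S D.t₀ ∘L posSqrt D.Pi0).inverse
    (posSqrt D.Pi0 ((W D.t₀).adjoint ((X t).adjoint z)))

variable (X W) in
/-- The costate `Φ(t, τ)^* z` for `τ ≤ t`, extended by `0`. -/
noncomputable def costate (t : D.Time) (z : Vec n) : ℝ → Vec n :=
  (Iic (t : ℝ)).indicator fun τ => (W τ).adjoint ((X t).adjoint z)

theorem memLp_costate (hc : D.IsClosedLoop S X W) (t : D.Time) (z : Vec n) :
    MemLp (costate X W t z) ⊤ D.vol := by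
  have h1 := (hc.costate_isPrimitiveOn ((X t).adjoint z)).continuousOn
  obtain ⟨C, hC⟩ := isCompact_Icc.exists_bound_of_continuousOn h1
  exact (memLp_top_of_bound (h1.aestronglyMeasurable measurableSet_Icc) C
    ((ae_restrict_mem measurableSet_Icc).mono hC)).indicator measurableSet_Iic

theorem integrable_inverse_GQG_costate (h : D.Regular) (hc : D.IsClosedLoop S X W) (t : D.Time)
    (z : Vec n) : IntegrableOn (fun τ => W τ (D.GQG τ (costate X W t z τ))) (Icc D.t₀ D.T) := by
  have h1 : Integrable (fun τ => D.GQG τ (costate X W t z τ)) D.vol :=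
    memLp_one_iff_integrable.1 ((ContinuousLinearMap.id ℝ (Vec n →L[ℝ] Vec n)).memLp_of_bilin
      (p := 1) (q := ⊤) 1 (memLp_one_iff_integrable.2 h.integrable_GQG) (hc.memLp_costate t z))
  exact (ContinuousLinearMap.id ℝ (Vec n →L[ℝ] Vec n)).integrableOn_bilin_left
    hc.inverse.continuousOn h1

variable (D S X W) in
/-- The kernel function `K(·, t | T) z`, as a function of a real variable. -/
noncomputable def kernelFun (t : D.Time) (z : Vec n) (s : ℝ) : Vec n :=
  X s (W D.t₀ (posSqrt D.Pi0 (kernelParam D S X W t z))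
    + ∫ τ in D.t₀..s, W τ (D.GQG τ (costate X W t z τ)))

/-- The upper limit min(s, t) is absorbed into the truncated costate and X(s) leaves the integral,
so that variation of constants becomes visible. -/
theorem kernelK_apply (h : D.Regular) (hc : D.IsClosedLoop S X W) (s t : D.Time) (z : Vec n) :
    D.kernelK S (fun s t => X s ∘L W t) s t z = kernelFun D S X W t z s := by
  have hadj : ∀ τ, (X t ∘L W τ).adjoint z = (W τ).adjoint ((X t).adjoint z) := fun τ => by
    rw [ContinuousLinearMap.adjoint_comp]
    rfl
  have hint : IntegrableOn (fun τ => (X s ∘L W τ) ∘L D.GQG τ ∘L (X t ∘L W τ).adjoint)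
      (Icc D.t₀ D.T) := by
    have hW : ∀ s, ContinuousOn (fun τ => X s ∘L W τ) (Icc D.t₀ D.T) := fun s =>
      continuousOn_const.clm_comp hc.inverse.continuousOn
    exact integrable_comp_left (hW s) (integrable_comp_right h.integrable_GQG
      ((ContinuousLinearMap.adjoint (𝕜 := ℝ) (E := Vec n) (F := Vec n)).continuous.comp_continuousOn
        (hW t)))
  have hmin : min (s : ℝ) t ∈ Icc D.t₀ D.T := ⟨le_min s.2.1 t.2.1, (min_le_left _ _).trans s.2.2⟩
  have h2 : IntervalIntegrable (fun τ => W τ (D.GQG τ (costate X W t z τ))) volume D.t₀ s :=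
    (hc.integrable_inverse_GQG_costate h t z).intervalIntegrable_of_mem D.left_mem s.2
  have h3 : (fun τ => X s (W τ (D.GQG τ (costate X W t z τ)))) = (Iic (t : ℝ)).indicator
      fun τ => X s (W τ (D.GQG τ ((W τ).adjoint ((X t).adjoint z)))) := by
    ext1 τ
    by_cases hτ : τ ∈ Iic (t : ℝ)
    · simp only [costate, indicator_of_mem hτ]
    · simp only [costate, indicator_of_notMem hτ, map_zero]
  rw [kernelFun, map_add, ← ContinuousLinearMap.intervalIntegral_comp_comm _ h2, h3,
    intervalIntegral_indicator_Iic _ s.2.1 t.2.1, kernelK, add_apply,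
    ContinuousLinearMap.intervalIntegral_apply (hint.intervalIntegrable_of_mem D.left_mem hmin)]
  simp only [ContinuousLinearMap.comp_apply, hadj, kernelParam]

/-- Variation of constants for the closed loop with source GQG*q; the feedback term is moved to the
source to exhibit an open-loop trajectory. -/
theorem kernelFun_isPrimitiveOn (h : D.Regular) (hc : D.IsClosedLoop S X W) (t : D.Time)
    (z : Vec n) :
    IsPrimitiveOn D.t₀ D.T (kernelFun D S X W t z) (fun τ => D.F τ (kernelFun D S X W t z τ)
      + D.GQG τ (costate X W t z τ - S τ (kernelFun D S X W t z τ))) := by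
  refine (hc.fundamental.clm_apply (IsPrimitiveOn.of_integrableOn
    (hc.integrable_inverse_GQG_costate h t z) _)).congr (fun _ _ => rfl) ?_
  filter_upwards [ae_restrict_mem measurableSet_Icc] with τ hτ
  rw [hc.apply_inverse τ hτ, map_sub]
  change _ = D.GQG τ (costate X W t z τ) + (D.F τ (kernelFun D S X W t z τ)
    - D.GQG τ (S τ (kernelFun D S X W t z τ)))
  abel

theorem kernelFun_left (hc : D.IsClosedLoop S X W) (t : D.Time) (z : Vec n) :
    kernelFun D S X W t z D.t₀ = posSqrt D.Pi0 (kernelParam D S X W t z) := by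
  rw [kernelFun, intervalIntegral.integral_same, add_zero, hc.apply_inverse _ D.left_mem]

variable (D S X W) in
/-- The control generating the kernel function `K(·, t | T) z`. -/
noncomputable def kernelCtrl (t : D.Time) (z : Vec n) (τ : ℝ) : Vec p :=
  (D.GQhalf τ).adjoint (costate X W t z τ - S τ (kernelFun D S X W t z τ))

theorem memLp_kernelCtrl (h : D.Regular) (hc : D.IsClosedLoop S X W) (t : D.Time) (z : Vec n) :
    MemLp (kernelCtrl D S X W t z) 2 D.vol := by
  have h1 : ContinuousOn (fun τ => S τ (kernelFun D S X W t z τ)) (Icc D.t₀ D.T) :=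
    hc.riccati.continuousOn.clm_apply (hc.kernelFun_isPrimitiveOn h t z).continuousOn
  obtain ⟨C, hC⟩ := isCompact_Icc.exists_bound_of_continuousOn h1
  have h2 : MemLp (fun τ => S τ (kernelFun D S X W t z τ)) ⊤ D.vol :=
    memLp_top_of_bound (h1.aestronglyMeasurable measurableSet_Icc) C
      ((ae_restrict_mem measurableSet_Icc).mono hC)
  exact (ContinuousLinearMap.id ℝ (Vec n →L[ℝ] Vec p)).memLp_of_bilin (p := 2) (q := ⊤) 2
    (memLp_adjoint h.memLp_GQhalf) ((hc.memLp_costate t z).sub h2)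

/-- Since GQG* = NN* with N = GQ^{1/2}, the source is N applied to the control. -/
theorem generates_kernelFun (h : D.Regular) (hc : D.IsClosedLoop S X W) (t : D.Time) (z : Vec n) :
    D.Generates (kernelParam D S X W t z) (kernelCtrl D S X W t z)
      (fun s : D.Time => kernelFun D S X W t z s) := by
  refine ⟨hc.memLp_kernelCtrl h t z, hc.kernelFun_left t z, hasDerivL1_iff.2 ?_⟩
  refine (hc.kernelFun_isPrimitiveOn h t z).congr (fun s hs => ext_apply _ hs) ?_
  filter_upwards [ae_restrict_mem measurableSet_Icc, h.GQG_eq] with τ hτ h1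
  rw [ext_apply _ hτ, h1]
  rfl

/-- The reproducing property of the kernel. -/
theorem reproducing (h : D.Regular) (hc : D.IsClosedLoop S X W) (t : D.Time) (z : Vec n)
    {ξ : Vec n} {u : ℝ → Vec p} {x : D.Time → Vec n} (hx : D.Generates ξ u x) :
    inner ℝ ξ (kernelParam D S X W t z)
      + (∫ τ in D.t₀..D.T, inner ℝ (u τ) (kernelCtrl D S X W t z τ))
      + D.stateForm x (fun s => kernelFun D S X W t z s) = inner ℝ (x t) z := by
  set κ := kernelFun D S X W t z
  set q := costate X W t z with hqdef
  set η := kernelParam D S X W t z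
  have hκ : IsPrimitiveOn D.t₀ D.T κ (fun τ => D.F τ (κ τ) + D.GQG τ (q τ - S τ (κ τ))) :=
    hc.kernelFun_isPrimitiveOn h t z
  have hu := hx.1
  have hv := hc.memLp_kernelCtrl h t z
  set v := kernelCtrl D S X W t z
  have hxp := hx.isPrimitiveOn
  set y := D.ext x with hydef
  set q₀ : ℝ → Vec n := fun τ => (W τ).adjoint ((X t).adjoint z) with hq₀
  set g : ℝ → Vec n → ℝ := fun τ w =>
    inner ℝ w (D.GQhalf τ (u τ)) + inner ℝ (S τ (D.GQG τ w)) (y τ) with hg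
  have hmem : ∀ᵐ τ ∂D.vol, τ ∈ Icc D.t₀ D.T := ae_restrict_mem measurableSet_Icc
  have hp1 : IsPrimitiveOn D.t₀ D.T (fun τ => inner ℝ (S τ (κ τ)) (y τ))
      (fun τ => g τ (q τ) - inner ℝ (u τ) (v τ) - inner ℝ (D.HRH τ (y τ)) (κ τ)) := by
    refine ((hc.riccati.clm_apply hκ).inner hxp).congr (fun _ _ => rfl) ?_
    filter_upwards [h.HRH_isPositive] with τ h1
    have h2 : inner ℝ (u τ) (v τ) = inner ℝ (q τ) (D.GQhalf τ (u τ))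
        - inner ℝ (S τ (κ τ)) (D.GQhalf τ (u τ)) := by
      change inner ℝ (u τ) ((D.GQhalf τ).adjoint (q τ - S τ (κ τ))) = _
      rw [ContinuousLinearMap.adjoint_inner_right, real_inner_comm, inner_sub_left]
    have h3 : inner ℝ (D.HRH τ (y τ)) (κ τ) = inner ℝ (D.HRH τ (κ τ)) (y τ) := by
      rw [h1.inner_left_eq_inner_right, real_inner_comm]
    have h4 : inner ℝ ((D.F τ).adjoint (S τ (κ τ))) (y τ) = inner ℝ (S τ (κ τ)) (D.F τ (y τ)) :=
      ContinuousLinearMap.adjoint_inner_left _ _ _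
    simp only [hg, h2, h3, map_add, map_sub, neg_apply, add_apply, sub_apply,
      ContinuousLinearMap.comp_apply, inner_add_right, inner_add_left, inner_sub_left,
      inner_neg_left, h4]
    ring
  have hp2 : IsPrimitiveOn D.t₀ D.T (fun τ => inner ℝ (q₀ τ) (y τ)) (fun τ => g τ (q₀ τ)) := by
    refine ((hc.costate_isPrimitiveOn ((X t).adjoint z)).inner hxp).congr (fun _ _ => rfl) ?_
    filter_upwards [hmem, h.ae_isPositive_GQG] with τ hτ h1
    have h2 : inner ℝ (S τ (D.GQG τ (q₀ τ))) (y τ) = inner ℝ (q₀ τ) (D.GQG τ (S τ (y τ))) := by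
      rw [(hc.isPositive τ hτ).inner_left_eq_inner_right, h1.inner_left_eq_inner_right]
    have h3 : inner ℝ ((D.F τ - D.GQG τ ∘L S τ).adjoint (q₀ τ)) (y τ)
        = inner ℝ (q₀ τ) ((D.F τ - D.GQG τ ∘L S τ) (y τ)) :=
      ContinuousLinearMap.adjoint_inner_left _ _ _
    change g τ (q₀ τ) = inner ℝ (q₀ τ) (D.F τ (y τ) + D.GQhalf τ (u τ))
      + inner ℝ (-(D.F τ - D.GQG τ ∘L S τ).adjoint (q₀ τ)) (y τ)
    rw [inner_neg_left, h3]
    simp only [hg, h2, sub_apply, ContinuousLinearMap.comp_apply, inner_sub_right,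
      inner_add_right]
    ring
  have hgq : (fun τ => g τ (q τ)) = (Iic (t : ℝ)).indicator fun τ => g τ (q₀ τ) := by
    ext1 τ
    by_cases hτ : τ ∈ Iic (t : ℝ)
    · simp only [hqdef, costate, indicator_of_mem hτ, hq₀]
    · simp only [hqdef, costate, indicator_of_notMem hτ, hg, map_zero, inner_zero_left, add_zero]
  have hi1 : IntegrableOn (fun τ => g τ (q τ)) (Icc D.t₀ D.T) := by
    rw [hgq]
    exact hp2.1.indicator measurableSet_Iic
  have hi2 : IntegrableOn (fun τ => inner ℝ (u τ) (v τ)) (Icc D.t₀ D.T) :=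
    memLp_one_iff_integrable.1 ((innerSL ℝ).memLp_of_bilin (p := 2) (q := 2) 1 hu hv)
  have hi3 : IntegrableOn (fun τ => inner ℝ (D.HRH τ (y τ)) (κ τ)) (Icc D.t₀ D.T) :=
    h.integrable_inner_HRH hxp.continuousOn hκ.continuousOn
  have e1 := hp1.eq_add_integral D.left_mem D.right_mem
  have e2 := hp2.eq_add_integral D.left_mem t.2
  have e3 : ∫ τ in D.t₀..D.T, g τ (q τ) = ∫ τ in D.t₀..t, g τ (q₀ τ) := by
    rw [hgq, intervalIntegral_indicator_Iic _ D.lt.le t.2.1, min_eq_right t.2.2]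
  have hi4 : IntegrableOn (fun τ => g τ (q τ) - inner ℝ (u τ) (v τ)) (Icc D.t₀ D.T) := hi1.sub hi2
  rw [intervalIntegral.integral_sub (hi4.intervalIntegrable_of_mem D.left_mem D.right_mem)
    (hi3.intervalIntegrable_of_mem D.left_mem D.right_mem),
    intervalIntegral.integral_sub (hi1.intervalIntegrable_of_mem D.left_mem D.right_mem)
    (hi2.intervalIntegrable_of_mem D.left_mem D.right_mem), e3] at e1
  have e4 : inner ℝ (q₀ t) (y t) = inner ℝ (x t) z := by
    rw [hq₀, ContinuousLinearMap.adjoint_inner_left, ContinuousLinearMap.adjoint_inner_left,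
      hc.apply_inverse t t.2, hydef, ext_apply x t.2, real_inner_comm]
  have e5 : inner ℝ ξ η + inner ℝ (S D.t₀ (κ D.t₀)) (y D.t₀) = inner ℝ (q₀ D.t₀) (y D.t₀) := by
    have hs := posSqrt_isPositive D.Pi0
    have h1 : η + posSqrt D.Pi0 (S D.t₀ (posSqrt D.Pi0 η)) = posSqrt D.Pi0 (q₀ D.t₀) :=
      hc.apply_inverse_id_add _
    have h2 : κ D.t₀ = posSqrt D.Pi0 η := hc.kernelFun_left t z
    rw [hydef, hx.ext_left, h2, ← hs.inner_left_eq_inner_right, ← hs.inner_left_eq_inner_right,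
      ← h1, inner_add_left, real_inner_comm η ξ]
  have e6 : D.stateForm x (fun s => κ s) = inner ℝ (S D.T (κ D.T)) (y D.T)
      + ∫ τ in D.t₀..D.T, inner ℝ (D.HRH τ (y τ)) (κ τ) := by
    rw [stateForm, hc.final, h.SigmaT_isPositive.inner_left_eq_inner_right, real_inner_comm,
      hydef, ext_apply x D.right_mem]
    congr 1
    refine intervalIntegral.integral_congr fun τ hτ => ?_
    rw [uIcc_of_le D.lt.le] at hτ
    beta_reduce
    rw [ext_apply (fun s : D.Time => κ s) hτ]
  rw [e6]
  linarith

end IsClosedLoop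

end LQData

namespace LQData

variable {n p m : ℕ} {D : LQData n p m}

theorem Regular.isTrajectoryRKHS (h : D.Regular) {S X W : ℝ → Vec n →L[ℝ] Vec n}
    (hc : D.IsClosedLoop S X W) {L : D.Ctrl →L[ℝ] (D.Time → Vec n)} (hL : IsTrajMap L) :
    D.IsTrajectoryRKHS D.trajSpace (D.kernelK S fun s t => X s ∘L W t) := by
  refine hL.isTrajectoryRKHS h fun t z => ?_
  have hk := (hL.generates_iff _ _ (hc.memLp_kernelCtrl h t z) _).1 (hc.generates_kernelFun h t z)
  refine ⟨_, hk.trans (funext fun s => (hc.kernelK_apply h s t z).symm), fun l => ?_⟩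
  rw [hk, ← hc.reproducing h t z (hL.generates l)]
  conv_lhs => rw [← ctrl_eta l]
  rw [inner_ctrl, ctrl_eta]

/-- If `F` is square integrable and `G Q^{1/2}` is bounded, the trajectories are of class `H¹`. -/
theorem trajSpaceH1_eq (hF : MemLp D.F 2 D.vol) (hN : MemLp D.GQhalf ⊤ D.vol) :
    D.trajSpaceH1 = D.trajSpace := by
  refine Subset.antisymm (fun x hx => hx.2) fun x hx => ⟨?_, hx⟩
  obtain ⟨ξ, u, hx⟩ := hx
  obtain ⟨C, hC⟩ := isCompact_Icc.exists_bound_of_continuousOn hx.continuousOn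
  have h1 : MemLp (D.ext x) ⊤ D.vol :=
    memLp_top_of_bound (hx.continuousOn.aestronglyMeasurable measurableSet_Icc) C
      ((ae_restrict_mem measurableSet_Icc).mono hC)
  exact ⟨_, ((ContinuousLinearMap.id ℝ (Vec n →L[ℝ] Vec n)).memLp_of_bilin 2 hF h1).add
    ((ContinuousLinearMap.id ℝ (Vec p →L[ℝ] Vec n)).memLp_of_bilin 2 hN hx.1), hx.2.2⟩

end LQData

theorem mainTheorem2 {n p m : ℕ} (D : LQData n p m)
    (hF : MemLp D.F 1 D.vol) (hG : MemLp D.G 2 D.vol) (hQ : MemLp D.Q 1 D.vol)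
    (hGQ : MemLp D.GQhalf 2 D.vol)
    (hH : MemLp D.H 2 D.vol) (hR : MemLp D.R 2 D.vol)
    (hQpos : ∀ᵐ t ∂D.vol, (D.Q t).IsPositive)
    (hRpos : ∃ r : ℝ, 0 < r ∧
      ∀ᵐ t ∂D.vol, (D.R t - r • ContinuousLinearMap.id ℝ (Vec m)).IsPositive)
    (hPi0 : D.Pi0.IsPositive) (hSigmaT : D.SigmaT.IsPositive) :
    ∃ (S : ℝ → Vec n →L[ℝ] Vec n) (Φ : ℝ → ℝ → Vec n →L[ℝ] Vec n),
      -- the Riccati equation has a unique solution, and it is positive semidefinite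
      D.IsRiccati S ∧
      (∀ S', D.IsRiccati S' → Set.EqOn S' S (Set.Icc D.t₀ D.T)) ∧
      (∀ t ∈ Set.Icc D.t₀ D.T, (S t).IsPositive) ∧
      -- it has a unique associated evolution family
      D.IsEvolution S Φ ∧
      (∀ Φ', D.IsEvolution S Φ' →
        ∀ s ∈ Set.Icc D.t₀ D.T, ∀ t ∈ Set.Icc D.t₀ D.T, Φ' s t = Φ s t) ∧
      -- every trajectory has a unique representative
      (∀ x ∈ D.trajSpace, ∃ ξ u, D.IsRepresentative ξ u x ∧
        ∀ ξ' u', D.IsRepresentative ξ' u' x → ξ' = ξ ∧ u' =ᵐ[D.vol] u) ∧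
      -- the controlled trajectories form an RKHS with kernel `K`
      D.IsTrajectoryRKHS D.trajSpace (D.kernelK S Φ) ∧
      -- under square integrability of `F` and boundedness of `G Q^{1/2}` they are all in `H¹`
      (MemLp D.F 2 D.vol → MemLp D.GQhalf ⊤ D.vol →
        D.trajSpaceH1 = D.trajSpace ∧
        D.IsTrajectoryRKHS D.trajSpaceH1 (D.kernelK S Φ)) := by
  have h := LQData.regular_of_memLp hF hGQ hH hR hQpos hRpos hPi0 hSigmaT
  obtain ⟨S, X, W, hc⟩ := h.exists_isClosedLoop
  obtain ⟨L, hbound, hgen⟩ := h.exists_trajMap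
  have hL : LQData.IsTrajMap L := ⟨hbound, hgen⟩
  have hK := h.isTrajectoryRKHS hc hL
  refine ⟨S, fun s t => X s ∘L W t, hc.isRiccati, fun S' hS' => hc.eqOn_of_isRiccati h hS',
    hc.isPositive, hc.isEvolution, fun Φ' hΦ' s hs t ht => hc.eq_of_isEvolution h hΦ' hs ht,
    fun x hx => hL.exists_unique_representative hx, hK, fun hF2 hN => ?_⟩
  have heq := LQData.trajSpaceH1_eq hF2 hN
  exact ⟨heq, heq.symm ▸ hK⟩
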